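/- Let $\lambda>3$ be an integer, $\mathbb D=\{Z\in Mat_{2\times 2}(\mathbb C): E-Z^*Z>0\}$ with closure $\overline{\mathbb D}$, and let $L^2\mathcal O(\mathbb D,d\mu_\lambda)$ be the space of holomorphic functions on $\mathbb D$ that are square integrable with respect to $$d\mu_\lambda(Z)=c_\lambda\det(E-Z^*Z)^{\lambda-4}|dZ|,\qquad c_\lambda=\pi^{-4}(\lambda-1)(\lambda-2)^2(\lambda-3),$$ where $|dZ|$ is Lebesgue measure. Let $\mathcal H$ be the Hilbert space (inner product antilinear in the first variable) with coherent states $|Z\rangle\in\mathcal H$, $Z\in\mathbb D$, that is identified with $L^2\mathcal O(\mathbb D,d\mu_\lambda)$ by the antilinear isometric bijection $I_\lambda:\psi\mapsto\langle\psi|\,\cdot\,\rangle$; explicitly, $\mathcal H$ is the space of complex conjugates of functions in $L^2\mathcal O(\mathbb D,d\mu_\lambda)$, $I_\lambda$ is complex conjugation, and $|Z\rangle$ is the vector with $\langle\psi|Z\rangle=(I_\lambda\psi)(Z)$ for all $\psi\in\mathcal H$. The vacuum is the vector $|0\rangle$ (the coherent state at $Z=0$, for which $I_\lambda|0\rangle=1$).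 For $f\in H^\infty(\mathbb D)$ (bounded and holomorphic on $\mathbb D$) let $a(f)$ be the unique bounded operator on $\mathcal H$ with $a(f)|Z\rangle=f(Z)|Z\rangle$ for all $Z\in\mathbb D$. Put $\mathcal P^{++}=\{a(f):f\in H^\infty(\mathbb D)\}$ and $a_{kl}=a(z_{kl})$, $k,l=1,2$. Let $\mathcal P^{++}_{pol}$ be the operator-norm closed unital algebra generated by $a_{11},a_{12},a_{21},a_{22}$, let $\overline{\mathcal P^{++}_{pol}}=\{A^*:A\in\mathcal P^{++}_{pol}\}$, and let $\overline{Pol(\overline{\mathbb D})}$ be the closure, in $C(\overline{\mathbb D})$ with the supremum norm, of the algebra of polynomials in the four matrix entries restricted to $\overline{\mathbb D}$. Then: (i) There is an isometric algebra isomorphism of $\overline{Pol(\overline{\mathbb D})}$ onto $\mathcal P^{++}_{pol}$ sending $f$ to $a(f|_{\mathbb D})$. For $f\in H^\infty(\mathbb D)$, one has $a(f)\in\mathcal P^{++}_{pol}$ if and only if $f$ extends continuously to $\overline{\mathbb D}$. The maximal ideal space (the space of characters with the Gelfand topology) of $\mathcal P^{++}_{pol}$ is homeomorphic to $\overline{\mathbb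 D}$, by $\chi\mapsto(\chi(a_{kl}))_{k,l}$. (ii) $\mathcal P^{++}_{pol}$ is semisimple: its Jacobson radical is $0$, and if $p\in\mathcal P^{++}_{pol}$ is such that $1+cp$ is invertible (as a bounded operator) for every $c\in\mathbb C$, then $p=0$. (iii) $\mathcal P^{++}_{pol}$ is a proper subalgebra of $\mathcal P^{++}$. (iv) The vacuum is cyclic for $\overline{\mathcal P^{++}_{pol}}$: the set $\{B|0\rangle: B\in\overline{\mathcal P^{++}_{pol}}\}$ is dense in $\mathcal H$. -/

import Mathlib

noncomputable section

namespace MatrixBall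

open MeasureTheory Metric Set
open scoped Matrix ComplexConjugate ENNReal NNReal ComplexOrder InnerProductSpace

/-- The coordinate space of complex `2 × 2` matrices. -/
abbrev Mat2 : Type := Fin 2 → Fin 2 → ℂ

/-- The Hermitian matrix `E - Z* Z`. -/
def defect (Z : Mat2) : Matrix (Fin 2) (Fin 2) ℂ := 1 - (Matrix.of Z)ᴴ * Matrix.of Z

/-- The matrix matBall `𝔻 = {Z : E - Z* Z > 0}`. -/
def matBall : Set Mat2 := {Z | (defect Z).PosDef}

theorem continuous_defect : Continuous defect := by
  have hM : Continuous fun Z : Mat2 => Matrix.of Z := continuous_id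
  exact continuous_const.sub (hM.matrix_conjTranspose.matrix_mul hM)

theorem isHermitian_defect (Z : Mat2) : (defect Z).IsHermitian :=
  Matrix.isHermitian_one.sub (Matrix.isHermitian_conjTranspose_mul_self _)

theorem isOpen_ball : IsOpen matBall := by
  let q : Mat2 × sphere (0 : Fin 2 → ℂ) 1 → ℝ := fun p =>
    (star p.2.1 ⬝ᵥ (defect p.1 *ᵥ p.2.1)).re
  have hq : Continuous q := by
    have h2 : Continuous fun p : Mat2 × sphere (0 : Fin 2 → ℂ) 1 => p.2.1 :=
      continuous_subtype_val.comp continuous_snd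
    exact Complex.continuous_re.comp
      (Continuous.dotProduct (continuous_star.comp h2)
        ((continuous_defect.comp continuous_fst).matrix_mulVec h2))
  have hcl : IsClosed (Prod.fst '' {p | q p ≤ 0}) :=
    isClosedMap_fst_of_compactSpace _ (isClosed_le hq continuous_const)
  have : matBall = (Prod.fst '' {p | q p ≤ 0})ᶜ := by
    ext Z
    constructor
    · rintro hZ ⟨⟨Z', v⟩, h1, rfl⟩
      have hv : v.1 ≠ 0 := by
        intro h
        simpa [h] using v.2
      have := Matrix.PosDef.dotProduct_mulVec_pos (M := defect Z') hZ hv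
      exact absurd (Complex.pos_iff.1 this).1 (not_lt.mpr h1)
    · intro hZ
      refine Matrix.posDef_iff_dotProduct_mulVec.2 ⟨isHermitian_defect Z, fun v hv => ?_⟩
      have him := (isHermitian_defect Z).im_star_dotProduct_mulVec_self v
      refine Complex.pos_iff.2 ⟨?_, him.symm⟩
      by_contra hle
      push Not at hle
      have hn : ‖v‖ ≠ 0 := norm_ne_zero_iff.2 hv
      refine hZ ⟨(Z, ⟨((‖v‖⁻¹ : ℝ) : ℂ) • v, ?_⟩), ?_, rfl⟩
      · simp [norm_smul, hn]
      · simp only [q, mem_ofPred_eq, Matrix.mulVec_smul, star_smul, smul_dotProduct,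
          dotProduct_smul, smul_eq_mul]
        rw [Complex.star_def, Complex.conj_ofReal, Complex.re_ofReal_mul, Complex.re_ofReal_mul]
        have : 0 ≤ ‖v‖⁻¹ := by positivity
        exact mul_nonpos_of_nonneg_of_nonpos this (mul_nonpos_of_nonneg_of_nonpos this hle)
  rw [this]; exact hcl.isOpen_compl

theorem zero_mem_ball : (0 : Mat2) ∈ matBall := by
  have : defect 0 = 1 := by
    have h : (Matrix.of (0 : Mat2)) = 0 := rfl
    simp [defect, h]
  simpa [matBall, this] using Matrix.PosDef.one

theorem norm_apply_le_one {Z : Mat2} (hZ : Z ∈ matBall) (k l : Fin 2) : ‖Z k l‖ ≤ 1 := by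
  have h := Matrix.PosDef.diag_pos (A := defect Z) hZ (i := l)
  have h1 := (Complex.pos_iff.1 h).1
  have h2 : (defect Z l l).re = 1 - ∑ i, ‖Z i l‖ ^ 2 := by
    simp [defect, Matrix.mul_apply, ← Complex.normSq_eq_norm_sq, Complex.normSq_apply]
  rw [h2] at h1
  have h3 : ‖Z k l‖ ^ 2 ≤ ∑ i, ‖Z i l‖ ^ 2 :=
    Finset.single_le_sum (f := fun i => ‖Z i l‖ ^ 2) (fun i _ => by positivity) (Finset.mem_univ k)
  nlinarith [norm_nonneg (Z k l)]

theorem ball_subset : matBall ⊆ closedBall 0 1 := fun Z hZ => by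
  rw [mem_closedBall_zero_iff]
  exact (pi_norm_le_iff_of_nonneg zero_le_one).2 fun k =>
    (pi_norm_le_iff_of_nonneg zero_le_one).2 fun l => norm_apply_le_one hZ k l

theorem isCompact_closure_ball : IsCompact (closure matBall) :=
  (isCompact_closedBall (0 : Mat2) 1).of_isClosed_subset isClosed_closure
    (closure_minimal ball_subset isClosed_closedBall)

instance : CompactSpace (closure matBall) := isCompact_iff_compactSpace.1 isCompact_closure_ball

/-- `c_λ det(E - Z* Z)^(λ - 4)` with `c_λ = π⁻⁴ (λ - 1)(λ - 2)²(λ - 3)`. -/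
def density (lam : ℕ) (Z : Mat2) : ℝ :=
  (Real.pi ^ 4)⁻¹ * ((lam - 1 : ℝ) * (lam - 2 : ℝ) ^ 2 * (lam - 3 : ℝ)) *
    (defect Z).det.re ^ (lam - 4)

/-- The measure `dμ_λ = c_λ det(E - Z* Z)^(λ - 4) |dZ|` on `𝔻` (extended by zero). -/
def mu (lam : ℕ) : Measure Mat2 :=
  (volume.restrict matBall).withDensity fun Z => ENNReal.ofReal (density lam Z)

theorem continuous_density (lam : ℕ) : Continuous (density lam) :=
  continuous_const.mul ((Complex.continuous_re.comp continuous_defect.matrix_det).pow _)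

theorem density_pos {lam : ℕ} (hlam : 3 < lam) {Z : Mat2} (hZ : Z ∈ matBall) : 0 < density lam Z := by
  have h1 : 0 < (defect Z).det.re := (Complex.pos_iff.1 (Matrix.PosDef.det_pos hZ)).1
  have h2 : (3 : ℝ) < lam := by exact_mod_cast hlam
  have h3 : (0 : ℝ) < lam - 1 := by linarith
  have h4 : (0 : ℝ) < lam - 2 := by linarith
  have h5 : (0 : ℝ) < lam - 3 := by linarith
  have := Real.pi_pos
  unfold density
  positivity

instance (lam : ℕ) : IsFiniteMeasure (mu lam) := by
  obtain ⟨C, hC⟩ := isCompact_closure_ball.exists_bound_of_continuousOn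
    (continuous_density lam).continuousOn
  refine isFiniteMeasure_withDensity ?_
  have : ∫⁻ Z in matBall, ENNReal.ofReal (density lam Z) ≤ ENNReal.ofReal C * volume matBall := by
    rw [← setLIntegral_const]
    refine setLIntegral_mono' isOpen_ball.measurableSet fun Z hZ => ?_
    exact ENNReal.ofReal_le_ofReal ((le_abs_self _).trans (hC Z (subset_closure hZ)))
  refine (this.trans_lt (ENNReal.mul_lt_top ENNReal.ofReal_lt_top ?_)).ne
  exact (measure_mono subset_closure).trans_lt isCompact_closure_ball.measure_lt_top

theorem mu_absolutelyContinuous (lam : ℕ) : mu lam ≪ volume.restrict matBall :=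
  withDensity_absolutelyContinuous _ _

theorem restrict_absolutelyContinuous_mu {lam : ℕ} (hlam : 3 < lam) :
    volume.restrict matBall ≪ mu lam := by
  refine withDensity_absolutelyContinuous' ?_ ?_
  · exact (ENNReal.measurable_ofReal.comp (continuous_density lam).measurable).aemeasurable
  · refine (ae_restrict_iff' isOpen_ball.measurableSet).2 (Filter.Eventually.of_forall fun Z hZ => ?_)
    simpa using density_pos hlam hZ

theorem eqOn_of_ae_eq {lam : ℕ} (hlam : 3 < lam) {f g : Mat2 → ℂ} (hf : ContinuousOn f matBall)
    (hg : ContinuousOn g matBall) (h : f =ᵐ[mu lam] g) : EqOn f g matBall :=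
  have : (volume : Measure Mat2).IsOpenPosMeasure := Measure.pi.isOpenPosMeasure _
  Measure.eqOn_open_of_ae_eq ((restrict_absolutelyContinuous_mu hlam).ae_le h) isOpen_ball hf hg

theorem aestronglyMeasurable_of_continuousOn (lam : ℕ) {f : Mat2 → ℂ} (hf : ContinuousOn f matBall) :
    AEStronglyMeasurable f (mu lam) :=
  (hf.aestronglyMeasurable isOpen_ball.measurableSet).mono_ac (mu_absolutelyContinuous lam)

/-- On compact subsets of the matBall Lebesgue measure is dominated by `μ_λ`. -/
theorem restrict_le_smul_mu {lam : ℕ} (hlam : 3 < lam) {K : Set Mat2} (hK : IsCompact K)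
    (hKb : K ⊆ matBall) : ∃ C : ℝ≥0, volume.restrict K ≤ (C : ℝ≥0∞) • mu lam := by
  rcases K.eq_empty_or_nonempty with rfl | hne
  · exact ⟨0, by simp⟩
  obtain ⟨W, hW, hmin⟩ := hK.exists_isMinOn hne (continuous_density lam).continuousOn
  have hm := density_pos hlam (hKb hW)
  refine ⟨(density lam W)⁻¹.toNNReal, Measure.le_iff.2 fun s hs => ?_⟩
  rw [Measure.smul_apply, smul_eq_mul, mu, withDensity_apply _ hs, Measure.restrict_restrict hs,
    Measure.restrict_apply hs]
  have h1 : ENNReal.ofReal (density lam W) * volume (s ∩ K) ≤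
      ∫⁻ Z in s ∩ matBall, ENNReal.ofReal (density lam Z) := by
    rw [← setLIntegral_const]
    refine (setLIntegral_mono' (hs.inter hK.measurableSet) fun Z hZ => ?_).trans
      (lintegral_mono_set (inter_subset_inter_right s hKb))
    exact ENNReal.ofReal_le_ofReal (hmin hZ.2)
  refine le_trans ?_ (mul_le_mul_right h1 _)
  rw [← mul_assoc, show (((density lam W)⁻¹.toNNReal : ℝ≥0) : ℝ≥0∞) =
    ENNReal.ofReal (density lam W)⁻¹ from rfl, ← ENNReal.ofReal_mul (by positivity),
    inv_mul_cancel₀ hm.ne']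
  simp

theorem measurePreserving_smul {c : ℂ} (hc : ‖c‖ = 1) :
    MeasurePreserving (fun u : Mat2 => c • u) := by
  let a : Circle := ⟨c, by simpa [Submonoid.unitSphere] using hc⟩
  have h : MeasurePreserving (fun z : ℂ => c * z) := (rotation a).measurePreserving
  exact volume_preserving_pi (f := fun (_ : Fin 2) (v : Fin 2 → ℂ) (i : Fin 2) => c * v i)
    fun _ => volume_preserving_pi (f := fun (_ : Fin 2) (z : ℂ) => c * z) fun _ => h

theorem mean_value_le {ψ : Mat2 → ℂ} (hψ : DifferentiableOn ℂ ψ matBall) {Z : Mat2} {r : ℝ}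
    (hZ : closedBall Z r ⊆ matBall) :
    ‖ψ Z‖ₑ * volume (closedBall Z r) ≤ ∫⁻ V in closedBall Z r, ‖ψ V‖ₑ := by
  have : (volume : Measure Mat2).IsAddHaarMeasure := Measure.pi.isAddHaarMeasure _
  let G : Mat2 → ℝ≥0∞ := (closedBall Z r).indicator fun V => ‖ψ V‖ₑ
  have hG : Measurable G := by
    have : ContinuousOn (fun V => ‖ψ V‖ₑ) (closedBall Z r) :=
      (hψ.continuousOn.mono hZ).enorm
    classical
    have := this.measurable_piecewise (g := fun _ => 0) continuousOn_const
      (isClosed_closedBall.measurableSet)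
    have h0 := piecewise_eq_indicator (s := closedBall Z r) (f := fun V => ‖ψ V‖ₑ)
    change Measurable ((closedBall Z r).indicator fun V => ‖ψ V‖ₑ)
    rw [← h0]
    exact this
  have hc : ∀ θ : ℝ, ‖circleMap 0 1 θ‖ = 1 := fun θ => by simp
  have hint : ∀ θ : ℝ, ∫⁻ u : Mat2, G (Z + circleMap 0 1 θ • u) = ∫⁻ V, G V := fun θ => by
    rw [(measurePreserving_smul (hc θ)).lintegral_comp (f := fun u => G (Z + u)) (by fun_prop)]
    exact lintegral_add_left_eq_self G Z
  have hpt : ∀ u ∈ closedBall (0 : Mat2) r, ENNReal.ofReal (2 * Real.pi) * ‖ψ Z‖ₑ ≤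
      ∫⁻ θ in Ioc 0 (2 * Real.pi), G (Z + circleMap 0 1 θ • u) := by
    intro u hu
    have hmem : ∀ t ∈ closedBall (0 : ℂ) 1, Z + t • u ∈ closedBall Z r := by
      intro t ht
      rw [mem_closedBall_zero_iff] at ht hu
      rw [mem_closedBall_iff_norm, add_sub_cancel_left, norm_smul]
      nlinarith [norm_nonneg u]
    have hd : DiffContOnCl ℂ (fun t : ℂ => ψ (Z + t • u)) (Metric.ball 0 |1|) := by
      refine DifferentiableOn.diffContOnCl ?_
      rw [abs_one, closure_ball _ one_ne_zero]
      intro t ht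
      have h1 : DifferentiableAt ℂ ψ (Z + t • u) :=
        hψ.differentiableAt (isOpen_ball.mem_nhds (hZ (hmem t ht)))
      have h2 : DifferentiableAt ℂ (fun t : ℂ => Z + t • u) t := by fun_prop
      exact (h1.comp t h2).differentiableWithinAt
    have hav := hd.circleAverage
    simp only [zero_smul, add_zero, Real.circleAverage] at hav
    rw [← hav, enorm_smul, intervalIntegral.integral_of_le (by positivity), ← mul_assoc,
      Real.enorm_of_nonneg (by positivity), ← ENNReal.ofReal_mul (by positivity),
      mul_inv_cancel₀ (by positivity), ENNReal.ofReal_one, one_mul]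
    refine (enorm_integral_le_lintegral_enorm _).trans (lintegral_mono fun θ => ?_)
    have : Z + circleMap 0 1 θ • u ∈ closedBall Z r := hmem _ (by simp)
    simp only [G, indicator_of_mem this]
    exact le_rfl
  have hvol : volume (closedBall (0 : Mat2) r) = volume (closedBall Z r) := by
    rw [← measure_preimage_add_right volume (-Z) (closedBall (0 : Mat2) r)]
    congr 1
    ext V
    simp [dist_eq_norm, ← sub_eq_add_neg]
  have key : ENNReal.ofReal (2 * Real.pi) * (‖ψ Z‖ₑ * volume (closedBall Z r)) ≤
      ENNReal.ofReal (2 * Real.pi) * ∫⁻ V, G V := by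
    calc _ = ∫⁻ _ in closedBall (0 : Mat2) r, ENNReal.ofReal (2 * Real.pi) * ‖ψ Z‖ₑ := by
          rw [setLIntegral_const, hvol, mul_assoc]
      _ ≤ ∫⁻ u in closedBall (0 : Mat2) r,
            ∫⁻ θ in Ioc 0 (2 * Real.pi), G (Z + circleMap 0 1 θ • u) :=
          setLIntegral_mono' isClosed_closedBall.measurableSet hpt
      _ ≤ ∫⁻ u : Mat2, ∫⁻ θ in Ioc 0 (2 * Real.pi), G (Z + circleMap 0 1 θ • u) :=
          setLIntegral_le_lintegral _ _
      _ = ∫⁻ θ in Ioc 0 (2 * Real.pi), ∫⁻ u : Mat2, G (Z + circleMap 0 1 θ • u) := by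
          refine lintegral_lintegral_swap (Measurable.aemeasurable ?_)
          have : Continuous fun p : Mat2 × ℝ => Z + circleMap 0 1 p.2 • p.1 := by fun_prop
          exact hG.comp this.measurable
      _ = _ := by
          simp only [hint, lintegral_const]
          simp [mul_comm]
  rw [lintegral_indicator isClosed_closedBall.measurableSet] at key
  exact (ENNReal.mul_le_mul_iff_right (by simp [Real.pi_pos]) ENNReal.ofReal_ne_top).1 key

/-- Locally uniform bound of the point evaluations by the `L²(μ_λ)` norm. -/
theorem exists_eval_bound {lam : ℕ} (hlam : 3 < lam) {Z₀ : Mat2} (h₀ : Z₀ ∈ matBall) :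
    ∃ R > 0, ∃ C : ℝ≥0, Metric.ball Z₀ R ⊆ matBall ∧ ∀ ψ : Mat2 → ℂ, DifferentiableOn ℂ ψ matBall →
      ∀ Z ∈ Metric.ball Z₀ R, ‖ψ Z‖ₑ ≤ C * eLpNorm ψ 2 (mu lam) := by
  have : (volume : Measure Mat2).IsAddHaarMeasure := Measure.pi.isAddHaarMeasure _
  obtain ⟨r, hr, hsub⟩ := Metric.isOpen_iff.1 isOpen_ball Z₀ h₀
  have hsub' : closedBall Z₀ (r / 2) ⊆ matBall :=
    (closedBall_subset_ball (by linarith)).trans hsub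
  obtain ⟨C₁, hC₁⟩ := restrict_le_smul_mu hlam (isCompact_closedBall Z₀ (r / 2)) hsub'
  let v : ℝ≥0∞ := volume (closedBall (0 : Mat2) (r / 4))
  have hv0 : v ≠ 0 := (measure_closedBall_pos _ _ (by linarith)).ne'
  have hvt : v ≠ ⊤ := (isCompact_closedBall (0 : Mat2) (r / 4)).measure_lt_top.ne
  have hvol : ∀ Z : Mat2, volume (closedBall Z (r / 4)) = v := fun Z =>
    Measure.addHaar_closedBall_center _ _ _
  let M : ℝ≥0∞ := v⁻¹ * (C₁ * mu lam univ ^ ((1 : ℝ≥0∞).toReal⁻¹ - (2 : ℝ≥0∞).toReal⁻¹))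
  have hM : M ≠ ⊤ := by
    refine ENNReal.mul_ne_top (by simpa using hv0) (ENNReal.mul_ne_top ENNReal.coe_ne_top ?_)
    exact ENNReal.rpow_ne_top_of_nonneg (by norm_num) (measure_ne_top _ _)
  refine ⟨r / 4, by linarith, M.toNNReal, (Metric.ball_subset_ball (by linarith)).trans hsub,
    fun ψ hψ Z hZ => ?_⟩
  have hZs : closedBall Z (r / 4) ⊆ closedBall Z₀ (r / 2) := by
    refine closedBall_subset_closedBall' ?_
    have := mem_ball.1 hZ
    linarith
  have h1 := mean_value_le hψ (hZs.trans hsub')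
  rw [hvol] at h1
  have h2 : ∫⁻ V in closedBall Z (r / 4), ‖ψ V‖ₑ ≤ C₁ * eLpNorm ψ 1 (mu lam) := by
    refine (lintegral_mono_set hZs).trans ?_
    refine (lintegral_mono' hC₁ le_rfl).trans ?_
    rw [lintegral_smul_measure, eLpNorm_one_eq_lintegral_enorm, smul_eq_mul]
  have h3 := eLpNorm_le_eLpNorm_mul_rpow_measure_univ (p := 1) (q := 2) (by norm_num)
    (aestronglyMeasurable_of_continuousOn lam hψ.continuousOn)
  rw [ENNReal.coe_toNNReal hM]
  calc ‖ψ Z‖ₑ = v⁻¹ * (‖ψ Z‖ₑ * v) := by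
        rw [mul_comm ‖ψ Z‖ₑ, ← mul_assoc, ENNReal.inv_mul_cancel hv0 hvt, one_mul]
    _ ≤ v⁻¹ * (C₁ * (eLpNorm ψ 2 (mu lam) *
          mu lam univ ^ ((1 : ℝ≥0∞).toReal⁻¹ - (2 : ℝ≥0∞).toReal⁻¹))) := by
        refine mul_le_mul_right ((h1.trans h2).trans (mul_le_mul_right ?_ _)) _
        simpa using h3
    _ = M * eLpNorm ψ 2 (mu lam) := by simp only [M]; ring

/-- The Hilbert space `H` as a subspace of `L²(dμ_λ)`, realized so that the antilinear map
`I_λ ψ = ⟨ψ | · ⟩` onto `L²O(𝔻, dμ_λ)` is complex conjugation of functions: the elements of `H` are the classes in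
`L²(dμ_λ)` of the complex conjugates of holomorphic functions on `𝔻`. -/
def hilbertSubmodule (lam : ℕ) : Submodule ℂ (Lp ℂ 2 (mu lam)) where
  carrier := {g | ∃ ψ : Mat2 → ℂ, DifferentiableOn ℂ ψ matBall ∧ g =ᵐ[mu lam] fun Z => conj (ψ Z)}
  zero_mem' := ⟨0, differentiableOn_const 0, by
    filter_upwards [Lp.coeFn_zero ℂ 2 (mu lam)] with Z hZ
    simpa using hZ⟩
  add_mem' := by
    rintro f g ⟨φ, hφ, hf⟩ ⟨ψ, hψ, hg⟩
    refine ⟨φ + ψ, hφ.add hψ, ?_⟩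
    filter_upwards [Lp.coeFn_add f g, hf, hg] with Z h1 h2 h3
    rw [h1, Pi.add_apply, h2, h3, Pi.add_apply, map_add]
  smul_mem' := by
    rintro c g ⟨ψ, hψ, hg⟩
    refine ⟨conj c • ψ, hψ.const_smul _, ?_⟩
    filter_upwards [Lp.coeFn_smul c g, hg] with Z h1 h2
    simp [h1, h2]

theorem isClosed_hilbertSubmodule {lam : ℕ} (hlam : 3 < lam) :
    IsClosed (hilbertSubmodule lam : Set (Lp ℂ 2 (mu lam))) := by
  refine IsSeqClosed.isClosed fun g g₀ hg hlim => ?_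
  choose ψ hψ hgψ using hg
  have hnorm : ∀ n m, eLpNorm (ψ n - ψ m) 2 (mu lam) = ‖g n - g m‖ₑ := fun n m => by
    rw [Lp.enorm_def]
    refine eLpNorm_congr_norm_ae ?_
    filter_upwards [Lp.coeFn_sub (g n) (g m), hgψ n, hgψ m] with Z h1 h2 h3
    rw [h1, Pi.sub_apply, Pi.sub_apply, h2, h3, ← map_sub, RCLike.norm_conj]
  have hcau := hlim.cauchySeq
  have hloc : ∀ Z₀ ∈ matBall, ∃ R > 0, UniformCauchySeqOn ψ Filter.atTop (Metric.ball Z₀ R) ∧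
      Metric.ball Z₀ R ⊆ matBall := by
    intro Z₀ h₀
    obtain ⟨R, hR, C, hsub, hC⟩ := exists_eval_bound hlam h₀
    refine ⟨R, hR, ?_, hsub⟩
    rw [Metric.uniformCauchySeqOn_iff]
    intro ε hε
    obtain ⟨N, hN⟩ := Metric.cauchySeq_iff.1 hcau (ε / (C + 1)) (by positivity)
    refine ⟨N, fun m hm n hn Z hZ => ?_⟩
    have h1 := hC (ψ m - ψ n) ((hψ m).sub (hψ n)) Z hZ
    rw [hnorm, ← ofReal_norm, ← ofReal_norm, ← ENNReal.ofReal_coe_nnreal,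
      ← ENNReal.ofReal_mul (by positivity), ENNReal.ofReal_le_ofReal_iff (by positivity)] at h1
    have h2 := hN m hm n hn
    rw [dist_eq_norm] at h2 ⊢
    refine h1.trans_lt ?_
    rw [lt_div_iff₀ (by positivity)] at h2
    nlinarith [norm_nonneg (g m - g n)]
  have hex : ∀ Z ∈ matBall, ∃ w, Filter.Tendsto (fun n => ψ n Z) Filter.atTop (nhds w) := by
    intro Z hZ
    obtain ⟨R, hR, hU, -⟩ := hloc Z hZ
    exact cauchySeq_tendsto_of_complete (hU.cauchy_map (mem_ball_self hR))
  choose! φ hφ using hex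
  refine ⟨φ, ?_, ?_⟩
  · intro Z₀ h₀
    obtain ⟨R, hR, hU, hsub⟩ := hloc Z₀ h₀
    have hU' : UniformCauchySeqOn (fun n => fderiv ℂ (ψ n)) Filter.atTop
        (Metric.ball Z₀ (R / 2)) := by
      rw [Metric.uniformCauchySeqOn_iff] at hU ⊢
      intro ε hε
      obtain ⟨N, hN⟩ := hU (ε * R / 8) (by positivity)
      refine ⟨N, fun m hm n hn Z hZ => ?_⟩
      have hZR : Metric.ball Z (R / 2) ⊆ Metric.ball Z₀ R := by
        refine ball_subset_ball' ?_
        have := mem_ball.1 hZ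
        linarith
      have hZb := isOpen_ball.mem_nhds (hsub (hZR (mem_ball_self (half_pos hR))))
      have h1 := Complex.norm_fderiv_le_div_of_mapsTo_ball (f := ψ m - ψ n) (c := Z)
        (R₁ := R / 2) (R₂ := ε * R / 4) (((hψ m).sub (hψ n)).mono (hZR.trans hsub)) ?_
        (half_pos hR)
      · rw [fderiv_sub ((hψ m).differentiableAt hZb) ((hψ n).differentiableAt hZb)] at h1
        rw [dist_eq_norm]
        refine h1.trans_lt ?_
        field_simp
        linarith
      · intro V hV
        have h2 := hN m hm n hn V (hZR hV)
        have h3 := hN m hm n hn Z (hZR (mem_ball_self (half_pos hR)))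
        rw [dist_eq_norm] at h2 h3
        rw [mem_closedBall, dist_eq_norm]
        refine (norm_sub_le _ _).trans ?_
        simp only [Pi.sub_apply]
        linarith
    have hex' : ∀ Z ∈ Metric.ball Z₀ (R / 2), ∃ w,
        Filter.Tendsto (fun n => fderiv ℂ (ψ n) Z) Filter.atTop (nhds w) := fun Z hZ =>
      cauchySeq_tendsto_of_complete (hU'.cauchy_map hZ)
    choose! φ' hφ' using hex'
    have hT := hU'.tendstoUniformlyOn_of_tendsto hφ'
    have hbs : Metric.ball Z₀ (R / 2) ⊆ matBall := (ball_subset_ball (by linarith)).trans hsub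
    have := hasFDerivAt_of_tendstoUniformlyOn Metric.isOpen_ball hT
      (fun n Z hZ => ((hψ n).differentiableAt (isOpen_ball.mem_nhds (hbs hZ))).hasFDerivAt)
      (fun Z hZ => hφ Z (hbs hZ)) (mem_ball_self (half_pos hR))
    exact this.differentiableAt.differentiableWithinAt
  · obtain ⟨k, hkm, hk⟩ := (tendstoInMeasure_of_tendsto_Lp hlim).exists_seq_tendsto_ae
    have hb : ∀ᵐ Z ∂(mu lam), Z ∈ matBall :=
      (mu_absolutelyContinuous lam).ae_le (ae_restrict_mem isOpen_ball.measurableSet)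
    filter_upwards [hk, hb, ae_all_iff.2 hgψ] with Z h1 h2 h3
    have h4 := (Complex.continuous_conj.tendsto _).comp ((hφ Z h2).comp hkm.tendsto_atTop)
    refine tendsto_nhds_unique h1 (h4.congr fun n => ?_)
    simp [h3]

/-- The Hilbert space `H`, with the inner product of `L²(dμ_λ)` (antilinear in the first slot). -/
def Hilb (lam : ℕ) : Type := hilbertSubmodule lam

instance (lam : ℕ) : NormedAddCommGroup (Hilb lam) :=
  inferInstanceAs (NormedAddCommGroup (hilbertSubmodule lam))

instance (lam : ℕ) : InnerProductSpace ℂ (Hilb lam) :=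
  inferInstanceAs (InnerProductSpace ℂ (hilbertSubmodule lam))

instance (lam : ℕ) [h : Fact (3 < lam)] : CompleteSpace (Hilb lam) :=
  (isClosed_hilbertSubmodule h.out).completeSpace_coe

/-- The underlying class in `L²(dμ_λ)`. -/
def Hilb.toLp {lam : ℕ} (ψ : Hilb lam) : Lp ℂ 2 (mu lam) := Subtype.val ψ

theorem Hilb.ext {lam : ℕ} {φ ψ : Hilb lam} (h : φ.toLp = ψ.toLp) : φ = ψ := Subtype.ext h

/-- The map `I_λ`: the holomorphic function `Z ↦ ⟨ψ | Z⟩` on `𝔻` represented by `ψ ∈ H`. -/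
def holRep (lam : ℕ) (ψ : Hilb lam) : Mat2 → ℂ := ψ.2.choose

theorem differentiableOn_holRep (lam : ℕ) (ψ : Hilb lam) :
    DifferentiableOn ℂ (holRep lam ψ) matBall :=
  ψ.2.choose_spec.1

theorem coeFn_ae_eq (lam : ℕ) (ψ : Hilb lam) :
    ψ.toLp =ᵐ[mu lam] fun Z => conj (holRep lam ψ Z) := ψ.2.choose_spec.2

theorem holRep_eqOn (lam : ℕ) [hlam : Fact (3 < lam)] (ψ : Hilb lam) {φ : Mat2 → ℂ}
    (hφ : DifferentiableOn ℂ φ matBall)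
    (h : ψ.toLp =ᵐ[mu lam] fun Z => conj (φ Z)) : EqOn (holRep lam ψ) φ matBall := by
  refine eqOn_of_ae_eq hlam.out (differentiableOn_holRep lam ψ).continuousOn hφ.continuousOn ?_
  filter_upwards [coeFn_ae_eq lam ψ, h] with Z h1 h2
  exact (starRingEnd ℂ).injective (h1.symm.trans h2)

/-- The functional `ψ ↦ ⟨Z | ψ⟩`, the conjugate of the value of `I_λ ψ` at `Z ∈ 𝔻`. -/
def eval (lam : ℕ) [hlam : Fact (3 < lam)] (Z : matBall) : Hilb lam →L[ℂ] ℂ :=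
  LinearMap.mkContinuousOfExistsBound
    { toFun := fun ψ => conj (holRep lam ψ Z)
      map_add' := fun φ ψ => by
        rw [holRep_eqOn lam (φ + ψ)
          ((differentiableOn_holRep lam φ).add (differentiableOn_holRep lam ψ)) ?_ Z.2]
        · exact map_add _ _ _
        · filter_upwards [Lp.coeFn_add φ.toLp ψ.toLp, coeFn_ae_eq lam φ, coeFn_ae_eq lam ψ] with V h1 h2 h3
          rw [Pi.add_apply, map_add, ← h2, ← h3]
          exact h1
      map_smul' := fun c ψ => by
        rw [holRep_eqOn lam (c • ψ) ((differentiableOn_holRep lam ψ).const_smul (conj c)) ?_ Z.2]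
        · simp
        · filter_upwards [Lp.coeFn_smul c ψ.toLp, coeFn_ae_eq lam ψ] with V h1 h2
          rw [Pi.smul_apply, smul_eq_mul, map_mul, Complex.conj_conj, ← h2]
          exact h1 }
    (by
      obtain ⟨R, hR, C, -, hC⟩ := exists_eval_bound hlam.out Z.2
      refine ⟨C, fun ψ => ?_⟩
      have h1 := hC _ (differentiableOn_holRep lam ψ) Z (mem_ball_self hR)
      have h2 : eLpNorm (holRep lam ψ) 2 (mu lam) = ‖ψ‖ₑ := by
        change _ = ‖ψ.toLp‖ₑ
        rw [Lp.enorm_def]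
        refine eLpNorm_congr_norm_ae ?_
        filter_upwards [coeFn_ae_eq lam ψ] with V h
        rw [h, RCLike.norm_conj]
      rw [h2, ← ofReal_norm, ← ofReal_norm, ← ENNReal.ofReal_coe_nnreal,
        ← ENNReal.ofReal_mul (by positivity), ENNReal.ofReal_le_ofReal_iff (by positivity)] at h1
      simpa using h1)

/-- The coherent state `|Z⟩ ∈ H`, `Z ∈ 𝔻`: the vector with `⟨ψ | Z⟩ = (I_λ ψ)(Z)` for all `ψ`. -/
def coh (lam : ℕ) [Fact (3 < lam)] (Z : matBall) : Hilb lam :=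
  (InnerProductSpace.toDual ℂ (Hilb lam)).symm (eval lam Z)

theorem inner_coh_right (lam : ℕ) [Fact (3 < lam)] (ψ : Hilb lam) (Z : matBall) :
    ⟪ψ, coh lam Z⟫_ℂ = holRep lam ψ Z := by
  rw [← inner_conj_symm (𝕜 := ℂ), coh, InnerProductSpace.toDual_symm_apply]
  exact Complex.conj_conj _

/-- The vacuum vector: the coherent state at `Z = 0`, which corresponds under `I_λ` to the
constant function `1`. -/
def vacuum (lam : ℕ) [Fact (3 < lam)] : Hilb lam := coh lam ⟨0, zero_mem_ball⟩

theorem ext_holRep (lam : ℕ) {φ ψ : Hilb lam} (h : EqOn (holRep lam φ) (holRep lam ψ) matBall) :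
    φ = ψ := by
  refine Hilb.ext (Lp.ext ?_)
  have hb : ∀ᵐ Z ∂(mu lam), Z ∈ matBall :=
    (mu_absolutelyContinuous lam).ae_le (ae_restrict_mem isOpen_ball.measurableSet)
  filter_upwards [hb, coeFn_ae_eq lam φ, coeFn_ae_eq lam ψ] with Z h1 h2 h3
  rw [h2, h3, h h1]

/-- A bounded operator is determined by its values on the coherent states. -/
theorem ext_coh (lam : ℕ) [Fact (3 < lam)] {A B : Hilb lam →L[ℂ] Hilb lam}
    (h : ∀ Z, A (coh lam Z) = B (coh lam Z)) : A = B := by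
  refine (ContinuousLinearMap.adjoint (𝕜 := ℂ)).injective ?_
  ext1 ψ
  refine ext_holRep lam fun Z hZ => ?_
  rw [← inner_coh_right lam _ ⟨Z, hZ⟩, ← inner_coh_right lam _ ⟨Z, hZ⟩,
    ContinuousLinearMap.adjoint_inner_left, ContinuousLinearMap.adjoint_inner_left, h]

/-- Membership in `H^∞(𝔻)`: holomorphic and bounded on `𝔻`. -/
def IsHInf (f : Mat2 → ℂ) : Prop :=
  DifferentiableOn ℂ f matBall ∧ ∃ C : ℝ, ∀ Z ∈ matBall, ‖f Z‖ ≤ C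

/-- The operators `A` with `A |Z⟩ = f(Z) |Z⟩` for all `Z ∈ 𝔻`. -/
def IsAnnihilation (lam : ℕ) [Fact (3 < lam)] (f : Mat2 → ℂ) (A : Hilb lam →L[ℂ] Hilb lam) : Prop :=
  ∀ Z : matBall, A (coh lam Z) = f Z • coh lam Z

theorem memLp_conj_mul (lam : ℕ) {f : Mat2 → ℂ} (hf : IsHInf f) (ψ : Hilb lam) :
    MemLp (fun Z => conj (f Z) * ψ.toLp Z) 2 (mu lam) := by
  obtain ⟨C, hC⟩ := hf.2
  have hb : ∀ᵐ Z ∂(mu lam), Z ∈ matBall :=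
    (mu_absolutelyContinuous lam).ae_le (ae_restrict_mem isOpen_ball.measurableSet)
  refine (Lp.memLp ψ.toLp).of_le_mul (c := C) ?_ ?_
  · exact (Complex.continuous_conj.comp_aestronglyMeasurable
      (aestronglyMeasurable_of_continuousOn lam hf.1.continuousOn)).mul
      (Lp.aestronglyMeasurable ψ.toLp)
  · filter_upwards [hb] with Z hZ
    rw [norm_mul, RCLike.norm_conj]
    exact mul_le_mul_of_nonneg_right (hC Z hZ) (norm_nonneg _)

/-- The product `conj f · ψ`. -/
def conjMulFun (lam : ℕ) {f : Mat2 → ℂ} (hf : IsHInf f) (ψ : Hilb lam) : Hilb lam :=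
  (⟨(memLp_conj_mul lam hf ψ).toLp, fun Z => f Z * holRep lam ψ Z,
    hf.1.mul (differentiableOn_holRep lam ψ), by
      filter_upwards [MemLp.coeFn_toLp (memLp_conj_mul lam hf ψ), coeFn_ae_eq lam ψ] with Z h1 h2
      rw [h1, h2, map_mul]⟩ : hilbertSubmodule lam)

theorem coeFn_conjMulFun (lam : ℕ) {f : Mat2 → ℂ} (hf : IsHInf f) (ψ : Hilb lam) :
    (conjMulFun lam hf ψ).toLp =ᵐ[mu lam] fun Z => conj (f Z) * ψ.toLp Z :=
  MemLp.coeFn_toLp (memLp_conj_mul lam hf ψ)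

/-- Multiplication by `conj f`; the map `I_λ` turns it into multiplication by `f`. -/
def conjMul (lam : ℕ) [Fact (3 < lam)] {f : Mat2 → ℂ} (hf : IsHInf f) : Hilb lam →L[ℂ] Hilb lam :=
  LinearMap.mkContinuousOfExistsBound
    { toFun := conjMulFun lam hf
      map_add' := fun φ ψ => by
        refine Hilb.ext (Lp.ext ?_)
        filter_upwards [coeFn_conjMulFun lam hf (φ + ψ), coeFn_conjMulFun lam hf φ,
          coeFn_conjMulFun lam hf ψ, Lp.coeFn_add φ.toLp ψ.toLp,
          Lp.coeFn_add (conjMulFun lam hf φ).toLp (conjMulFun lam hf ψ).toLp] with Z h1 h2 h3 h4 h5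
        refine h1.trans (Eq.trans ?_ h5.symm)
        rw [Pi.add_apply, h2, h3, ← mul_add]
        exact congrArg _ h4
      map_smul' := fun c ψ => by
        refine Hilb.ext (Lp.ext ?_)
        filter_upwards [coeFn_conjMulFun lam hf (c • ψ), coeFn_conjMulFun lam hf ψ,
          Lp.coeFn_smul c ψ.toLp, Lp.coeFn_smul c (conjMulFun lam hf ψ).toLp] with Z h1 h2 h3 h4
        refine h1.trans (Eq.trans ?_ h4.symm)
        rw [Pi.smul_apply, h2, smul_eq_mul, mul_left_comm]
        exact congrArg _ h3 }
    (by
      obtain ⟨C, hC⟩ := hf.2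
      refine ⟨C, fun ψ => ?_⟩
      have hb : ∀ᵐ Z ∂(mu lam), Z ∈ matBall :=
        (mu_absolutelyContinuous lam).ae_le (ae_restrict_mem isOpen_ball.measurableSet)
      refine Lp.norm_le_mul_norm_of_ae_le_mul (f := (conjMulFun lam hf ψ).toLp) (g := ψ.toLp) ?_
      filter_upwards [hb, coeFn_conjMulFun lam hf ψ] with Z hZ h1
      rw [h1, norm_mul, RCLike.norm_conj]
      exact mul_le_mul_of_nonneg_right (hC Z hZ) (norm_nonneg _))

theorem holRep_conjMul (lam : ℕ) [Fact (3 < lam)] {f : Mat2 → ℂ} (hf : IsHInf f) (ψ : Hilb lam) :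
    EqOn (holRep lam (conjMul lam hf ψ)) (fun Z => f Z * holRep lam ψ Z) matBall := by
  refine holRep_eqOn lam _ (hf.1.mul (differentiableOn_holRep lam ψ)) ?_
  filter_upwards [coeFn_conjMulFun lam hf ψ, coeFn_ae_eq lam ψ] with Z h1 h2
  refine h1.trans ?_
  rw [h2, map_mul]

/-- The annihilation operator `a(f)`, `f ∈ H^∞(𝔻)`. -/
def annih (lam : ℕ) [Fact (3 < lam)] {f : Mat2 → ℂ} (hf : IsHInf f) : Hilb lam →L[ℂ] Hilb lam :=
  ContinuousLinearMap.adjoint (conjMul lam hf)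

/-- `a(f)` is characterized by `a(f) |Z⟩ = f(Z) |Z⟩`. -/
theorem isAnnihilation_iff (lam : ℕ) [Fact (3 < lam)] {f : Mat2 → ℂ} (hf : IsHInf f)
    (A : Hilb lam →L[ℂ] Hilb lam) : IsAnnihilation lam f A ↔ A = annih lam hf := by
  have key : IsAnnihilation lam f (annih lam hf) := fun Z => by
    refine ext_inner_left ℂ fun ψ => ?_
    rw [annih, ContinuousLinearMap.adjoint_inner_right, inner_smul_right, inner_coh_right,
      inner_coh_right, holRep_conjMul lam hf ψ Z.2]
  refine ⟨fun h => ext_coh lam fun Z => (h Z).trans (key Z).symm, ?_⟩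
  rintro rfl
  exact key

theorem isAnnihilation_annih (lam : ℕ) [Fact (3 < lam)] {f : Mat2 → ℂ} (hf : IsHInf f) :
    IsAnnihilation lam f (annih lam hf) := (isAnnihilation_iff lam hf _).2 rfl

theorem isHInf_coord (k l : Fin 2) : IsHInf fun Z => Z k l :=
  ⟨by fun_prop, 1, fun _ hZ => norm_apply_le_one hZ k l⟩

/-- The coordinate annihilation operators `a_kl`. -/
def coordOp (lam : ℕ) [Fact (3 < lam)] (k l : Fin 2) : Hilb lam →L[ℂ] Hilb lam :=
  annih lam (isHInf_coord k l)

/-- The algebra `P⁺⁺ = a(H^∞(𝔻))`. -/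
def Ppp (lam : ℕ) [Fact (3 < lam)] : Subalgebra ℂ (Hilb lam →L[ℂ] Hilb lam) where
  carrier := {A | ∃ (f : Mat2 → ℂ) (hf : IsHInf f), A = annih lam hf}
  add_mem' := by
    rintro _ _ ⟨f, hf, rfl⟩ ⟨g, hg, rfl⟩
    obtain ⟨C, hC⟩ := hf.2
    obtain ⟨D, hD⟩ := hg.2
    refine ⟨f + g, ⟨hf.1.add hg.1, C + D, fun Z hZ =>
      (norm_add_le _ _).trans (add_le_add (hC Z hZ) (hD Z hZ))⟩,
      (isAnnihilation_iff lam _ _).1 fun Z => ?_⟩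
    rw [add_apply, isAnnihilation_annih lam hf, isAnnihilation_annih lam hg,
      Pi.add_apply, add_smul]
  mul_mem' := by
    rintro _ _ ⟨f, hf, rfl⟩ ⟨g, hg, rfl⟩
    obtain ⟨C, hC⟩ := hf.2
    obtain ⟨D, hD⟩ := hg.2
    refine ⟨f * g, ⟨hf.1.mul hg.1, C * D, fun Z hZ => ?_⟩,
      (isAnnihilation_iff lam _ _).1 fun Z => ?_⟩
    · rw [Pi.mul_apply, norm_mul]
      exact mul_le_mul (hC Z hZ) (hD Z hZ) (norm_nonneg _) ((norm_nonneg _).trans (hC Z hZ))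
    · rw [mul_apply_eq_comp, isAnnihilation_annih lam hg, map_smul,
        isAnnihilation_annih lam hf, smul_smul, Pi.mul_apply, mul_comm]
  algebraMap_mem' := fun c => ⟨fun _ => c, ⟨differentiableOn_const c, ‖c‖, fun _ _ => le_rfl⟩,
    (isAnnihilation_iff lam _ _).1 fun Z => rfl⟩

/-- The Banach algebra `P⁺⁺_pol`: the norm closure of the unital algebra generated by the `a_kl`. -/
def Ppol (lam : ℕ) [Fact (3 < lam)] : Subalgebra ℂ (Hilb lam →L[ℂ] Hilb lam) :=
  (Algebra.adjoin ℂ (Set.range fun p : Fin 2 × Fin 2 => coordOp lam p.1 p.2)).topologicalClosure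

theorem coordOp_mem_Ppol (lam : ℕ) [Fact (3 < lam)] (k l : Fin 2) : coordOp lam k l ∈ Ppol lam :=
  Subalgebra.le_topologicalClosure _ (Algebra.subset_adjoin ⟨(k, l), rfl⟩)

/-- The restriction of a polynomial in the four matrix entries to the closed matBall. -/
def polRestrict : MvPolynomial (Fin 2 × Fin 2) ℂ →ₐ[ℂ] C(closure matBall, ℂ) :=
  MvPolynomial.aeval fun p => ⟨fun Z => Z.1 p.1 p.2,
    (continuous_apply_apply p.1 p.2).comp continuous_subtype_val⟩

/-- The closure of `Pol` in the sup norm on the closed matBall. -/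
def PolClosure : Subalgebra ℂ C(closure matBall, ℂ) := polRestrict.range.topologicalClosure

end MatrixBall

end

open MatrixBall

/-! Everything rests on one dictionary: an operator in `Ppol` has the coherent states as
eigenvectors, and its eigenvalues form a continuous function on the closed ball, its symbol
(`IsSymbol`). Products go to products. The operator norm equals the sup norm of the symbol
(`IsSymbol.norm_eq`): eigenvalues bound the norm from below, and `a(f)` is the adjoint of a
multiplication operator on `L²`, which bounds it from above. Hence Cauchy sequences of operators and
of symbols correspond.

A symbol `g` is holomorphic inside the ball, because pairing `A|Z⟩ = g(Z)|Z⟩` with the constant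
function `1` exhibits it as an element of the function space. A function continuous on the closed
ball and holomorphic inside is a uniform limit of polynomials (`mem_PolClosure`): its dilates have
uniformly convergent expansions into homogeneous polynomials. So the operators with a symbol are
exactly those of `Ppol`, which gives the isomorphism and the extension criterion.

Characters are contractive, so their values on the coordinates form a point that no linear
functional separates from the convex set of contractions; they are point evaluations. Semisimplicity
follows, since evaluations separate symbols. A singular inner function of one entry shows that the
inclusion in `Ppp` is proper.

For cyclicity, averaging over the circle action `Z ↦ cZ` makes homogeneous components of different
degrees orthogonal. A vector orthogonal to all polynomials is thus orthogonal to each of its own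
components, so all of them vanish. -/

noncomputable section

namespace MatrixBall

open MeasureTheory Metric Set
open scoped Matrix ComplexConjugate ENNReal NNReal ComplexOrder InnerProductSpace

/-! ### The ball as the set of strict contractions of `ℂ²` -/

/-- The linear action of a matrix on the Hermitian plane `ℂ²`. -/
def act (Z : Mat2) (v : EuclideanSpace ℂ (Fin 2)) : EuclideanSpace ℂ (Fin 2) :=
  WithLp.toLp 2 fun k => ∑ l, Z k l * v l

theorem act_apply (Z : Mat2) (v : EuclideanSpace ℂ (Fin 2)) (k : Fin 2) :
    act Z v k = ∑ l, Z k l * v l := rfl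

theorem act_smul (c : ℂ) (Z : Mat2) (v : EuclideanSpace ℂ (Fin 2)) :
    act (c • Z) v = c • act Z v := by
  ext k
  simp [act_apply, mul_assoc, mul_add]

theorem continuous_act (v : EuclideanSpace ℂ (Fin 2)) : Continuous fun Z => act Z v := by
  unfold act
  fun_prop

theorem dotProduct_defect (Z : Mat2) (v : EuclideanSpace ℂ (Fin 2)) :
    star (v : Fin 2 → ℂ) ⬝ᵥ (defect Z *ᵥ v) = ((‖v‖ ^ 2 - ‖act Z v‖ ^ 2 : ℝ) : ℂ) := by
  have h : ∀ w : EuclideanSpace ℂ (Fin 2),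
      star (w : Fin 2 → ℂ) ⬝ᵥ (w : Fin 2 → ℂ) = ((‖w‖ ^ 2 : ℝ) : ℂ) := fun w => by
    rw [EuclideanSpace.norm_sq_eq]
    simp [dotProduct, ← Complex.normSq_eq_conj_mul_self, Complex.normSq_eq_norm_sq]
  rw [Complex.ofReal_sub, ← h, ← h, defect, Matrix.sub_mulVec, dotProduct_sub, Matrix.one_mulVec,
    ← Matrix.mulVec_mulVec, Matrix.dotProduct_mulVec, ← Matrix.star_mulVec]
  rfl

theorem mem_matBall_iff {Z : Mat2} : Z ∈ matBall ↔ ∀ v, v ≠ 0 → ‖act Z v‖ < ‖v‖ := by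
  have h : ∀ v, (0 : ℂ) < ((‖v‖ ^ 2 - ‖act Z v‖ ^ 2 : ℝ) : ℂ) ↔ ‖act Z v‖ < ‖v‖ := fun v => by
    rw [Complex.zero_lt_real, sub_pos, sq_lt_sq₀ (norm_nonneg _) (norm_nonneg _)]
  rw [show Z ∈ matBall ↔ (defect Z).PosDef from Iff.rfl, Matrix.posDef_iff_dotProduct_mulVec]
  refine ⟨fun H v hv => ?_, fun H => ⟨isHermitian_defect Z, fun v hv => ?_⟩⟩
  · rw [← h, ← dotProduct_defect]
    exact H.2 fun h0 => hv (by ext i; exact congrFun h0 i)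
  · have := (h (WithLp.toLp 2 v)).2 (H _ (by simpa using hv))
    rwa [← dotProduct_defect] at this

theorem norm_act_le {Z : Mat2} (hZ : Z ∈ closure matBall) (v : EuclideanSpace ℂ (Fin 2)) :
    ‖act Z v‖ ≤ ‖v‖ := by
  refine closure_minimal (fun W hW => ?_)
    (isClosed_le (continuous_act v).norm (continuous_const (y := ‖v‖))) hZ
  rcases eq_or_ne v 0 with rfl | hv
  · have : act W 0 = 0 := by ext k; simp [act_apply]
    simp [this]
  · exact (mem_matBall_iff.1 hW v hv).le

theorem smul_mem_matBall_of_mem_closure {Z : Mat2} (hZ : Z ∈ closure matBall) {c : ℂ}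
    (hc : ‖c‖ < 1) : c • Z ∈ matBall := by
  refine mem_matBall_iff.2 fun v hv => ?_
  rw [act_smul, norm_smul]
  have := norm_act_le hZ v
  have := norm_pos_iff.2 hv
  nlinarith [norm_nonneg c, norm_nonneg (act Z v)]

theorem smul_mem_matBall {Z : Mat2} (hZ : Z ∈ matBall) {c : ℂ} (hc : ‖c‖ ≤ 1) :
    c • Z ∈ matBall := by
  refine mem_matBall_iff.2 fun v hv => ?_
  rw [act_smul, norm_smul]
  have := mem_matBall_iff.1 hZ v hv
  nlinarith [norm_nonneg c, norm_nonneg (act Z v)]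

theorem smul_mem_closure {Z : Mat2} (hZ : Z ∈ closure matBall) {c : ℂ} (hc : ‖c‖ ≤ 1) :
    c • Z ∈ closure matBall :=
  map_mem_closure (continuous_const_smul c) hZ fun _ hW => smul_mem_matBall hW hc

/-- A contraction becomes strict when scaled by `t < 1`; let `t` tend to `1`. With `norm_act_le`
this identifies the closed ball with all contractions. -/
theorem mem_closure_matBall {Z : Mat2} (hZ : ∀ v, ‖act Z v‖ ≤ ‖v‖) : Z ∈ closure matBall := by
  have h1 : ∀ t ∈ Ioo (0 : ℝ) 1, (t : ℂ) • Z ∈ matBall := fun t ht => by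
    refine mem_matBall_iff.2 fun v hv => ?_
    rw [act_smul, norm_smul, Complex.norm_real, Real.norm_of_nonneg ht.1.le]
    have := hZ v
    have := norm_pos_iff.2 hv
    nlinarith [ht.1, ht.2, norm_nonneg (act Z v)]
  have h2 : Continuous fun t : ℝ => (t : ℂ) • Z := by fun_prop
  have h3 : (1 : ℝ) ∈ closure (Ioo (0 : ℝ) 1) := by
    rw [closure_Ioo zero_ne_one]
    exact right_mem_Icc.2 zero_le_one
  simpa using map_mem_closure h2 h3 h1

/-- A point outside the closed ball is separated from it by a linear functional. -/
theorem exists_separating {W : Mat2} (hW : W ∉ closure matBall) :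
    ∃ c : Fin 2 → Fin 2 → ℂ, ∃ M : ℝ, (∀ Z ∈ closure matBall, ‖∑ k, ∑ l, c k l * Z k l‖ ≤ M) ∧
      M < ‖∑ k, ∑ l, c k l * W k l‖ := by
  obtain ⟨v, hv⟩ : ∃ v, ‖v‖ < ‖act W v‖ := by
    by_contra! h
    exact hW (mem_closure_matBall h)
  -- The separating functional is `Z ↦ ⟨Wv, Zv⟩`, with `v` a vector that `W` stretches:
  -- Cauchy–Schwarz bounds it by `‖Wv‖‖v‖` on contractions, while at `W` it equals `‖Wv‖²`.
  have key : ∀ Z : Mat2, ∑ k, ∑ l, conj (act W v k) * v l * Z k l = ⟪act W v, act Z v⟫_ℂ := by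
    intro Z
    rw [PiLp.inner_apply]
    refine Finset.sum_congr rfl fun k _ => ?_
    rw [act_apply Z, RCLike.inner_apply, Finset.sum_mul]
    exact Finset.sum_congr rfl fun l _ => by ring
  refine ⟨fun k l => conj (act W v k) * v l, ‖act W v‖ * ‖v‖, fun Z hZ => ?_, ?_⟩
  · rw [key]
    exact (norm_inner_le_norm _ _).trans
      (mul_le_mul_of_nonneg_left (norm_act_le hZ v) (norm_nonneg _))
  · rw [key, inner_self_eq_norm_sq_to_K, norm_pow]
    simp only [Complex.coe_algebraMap, Complex.norm_real, norm_norm]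
    nlinarith [norm_nonneg v]

/-! ### Circle invariance of the ball and of the measure -/

theorem smul_mem_matBall_iff {c : ℂ} (hc : ‖c‖ = 1) {Z : Mat2} : c • Z ∈ matBall ↔ Z ∈ matBall := by
  refine ⟨fun h => ?_, fun h => smul_mem_matBall h hc.le⟩
  have h0 : c ≠ 0 := norm_ne_zero_iff.1 (by rw [hc]; exact one_ne_zero)
  have := smul_mem_matBall h (c := c⁻¹) (by rw [norm_inv, hc, inv_one])
  rwa [inv_smul_smul₀ h0] at this

theorem defect_smul {c : ℂ} (hc : ‖c‖ = 1) (Z : Mat2) : defect (c • Z) = defect Z := by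
  have h : Matrix.of (c • Z) = c • Matrix.of Z := rfl
  have h2 : star c * c = 1 := by
    rw [Complex.star_def, ← Complex.normSq_eq_conj_mul_self, Complex.normSq_eq_norm_sq, hc]
    simp
  rw [defect, defect, h, Matrix.conjTranspose_smul, Matrix.smul_mul, Matrix.mul_smul, smul_smul, h2,
    one_smul]

/-- The measure `μ_λ` is invariant under `Z ↦ c Z`, `|c| = 1`. -/
theorem measurePreserving_smul_mu (lam : ℕ) {c : ℂ} (hc : ‖c‖ = 1) :
    MeasurePreserving (fun Z : Mat2 => c • Z) (mu lam) (mu lam) := by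
  have hm : Measurable fun Z : Mat2 => c • Z := measurable_const_smul c
  refine ⟨hm, Measure.ext fun s hs => ?_⟩
  have hd : Measurable fun Z : Mat2 => ENNReal.ofReal (density lam Z) :=
    ENNReal.measurable_ofReal.comp (continuous_density lam).measurable
  have hpre : (fun Z : Mat2 => c • Z) ⁻¹' (s ∩ matBall) = (fun Z => c • Z) ⁻¹' s ∩ matBall := by
    ext Z
    simp [smul_mem_matBall_iff hc]
  rw [Measure.map_apply hm hs, mu, withDensity_apply _ hs, withDensity_apply _ (hm hs),
    Measure.restrict_restrict hs, Measure.restrict_restrict (hm hs), ← hpre,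
    ← (measurePreserving_smul hc).setLIntegral_comp_preimage
      (hs.inter isOpen_ball.measurableSet) hd]
  refine lintegral_congr fun Z => ?_
  simp only [density, defect_smul hc]

theorem ae_mem_matBall (lam : ℕ) : ∀ᵐ Z ∂(mu lam), Z ∈ matBall :=
  (mu_absolutelyContinuous lam).ae_le (ae_restrict_mem isOpen_ball.measurableSet)

/-! ### Homogeneous expansion at the origin -/

/-- Directional derivatives of holomorphic functions are holomorphic. -/
theorem differentiableOn_fderiv_apply {U : Set Mat2} (hU : IsOpen U) {f : Mat2 → ℂ}
    (hf : DifferentiableOn ℂ f U) (v : Mat2) : DifferentiableOn ℂ (fun Z => fderiv ℂ f Z v) U := by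
  intro X hX
  refine DifferentiableAt.differentiableWithinAt ?_
  obtain ⟨δ, hδ, hδU, hδf⟩ : ∃ δ > 0, ball X δ ⊆ U ∧ ∀ Y ∈ ball X δ, dist (f Y) (f X) < 1 := by
    obtain ⟨δ₁, h1, h2⟩ := Metric.isOpen_iff.1 hU X hX
    obtain ⟨δ₂, h3, h4⟩ := Metric.continuousAt_iff.1
      (hf.differentiableAt (hU.mem_nhds hX)).continuousAt 1 one_pos
    exact ⟨min δ₁ δ₂, lt_min h1 h3, (ball_subset_ball (min_le_left _ _)).trans h2,
      fun Y hY => h4 (lt_of_lt_of_le hY (min_le_right _ _))⟩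
  -- Small enough that discs of radius `r` in direction `v`, centred in `ball X (δ / 4)`, stay in
  -- `ball X (δ / 2)`; the `+ 1` covers `v = 0`.
  set r : ℝ := δ / (4 * (‖v‖ + 1)) with hr
  have hr0 : 0 < r := by positivity
  have hrv : r * ‖v‖ < δ / 4 := by
    have : r * (‖v‖ + 1) = δ / 4 := by rw [hr]; field_simp
    nlinarith
  have hmem : ∀ Y ∈ ball X (δ / 4), ∀ t ∈ closedBall (0 : ℂ) r, Y + t • v ∈ ball X (δ / 2) := by
    intro Y hY t ht
    rw [mem_closedBall_zero_iff] at ht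
    rw [mem_ball, dist_eq_norm] at hY ⊢
    calc ‖Y + t • v - X‖ = ‖(Y - X) + t • v‖ := by congr 1; abel
      _ ≤ ‖Y - X‖ + ‖t‖ * ‖v‖ := (norm_add_le _ _).trans_eq (by rw [norm_smul])
      _ < δ / 2 := by nlinarith [mul_le_mul_of_nonneg_right ht (norm_nonneg v)]
  have hsub : ball X (δ / 2) ⊆ ball X δ := ball_subset_ball (by linarith)
  have hdiff : ∀ Y ∈ ball X (δ / 2), DifferentiableAt ℂ f Y := fun Y hY =>
    hf.differentiableAt (hU.mem_nhds (hδU (hsub hY)))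
  -- Cauchy estimate: `f` varies by less than `2` on each ball of radius `δ / 2` around such a `Y`.
  -- This constant dominates the derivative under the integral below.
  have hbound : ∀ Y ∈ ball X (δ / 2), ‖fderiv ℂ f Y‖ ≤ 2 / (δ / 2) := by
    intro Y hY
    have hYs : ball Y (δ / 2) ⊆ ball X δ := by
      refine ball_subset_ball' ?_
      have := mem_ball.1 hY
      linarith
    refine Complex.norm_fderiv_le_div_of_mapsTo_ball (hf.mono (hYs.trans hδU)) ?_ (half_pos hδ)
    intro W hW
    have h1 := hδf W (hYs hW)
    have h2 := hδf Y (hsub hY)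
    rw [mem_closedBall]
    linarith [dist_triangle_right (f W) (f Y) (f X)]
  have hcirc : ∀ θ : ℝ, circleMap 0 r θ ∈ closedBall (0 : ℂ) r := fun θ =>
    circleMap_mem_closedBall _ hr0.le _
  -- The Cauchy kernel for a first derivative in one variable. It writes `fderiv ℂ f Y v` as an
  -- integral of values of `f`, and such an integral can be differentiated in `Y` once more.
  let a : ℝ → ℂ := fun θ => deriv (circleMap 0 r) θ * (1 / (circleMap 0 r θ - 0) ^ (1 + 1))
  have ha : Continuous a := by
    have h0 : ∀ θ, (circleMap 0 r θ - 0) ^ (1 + 1) ≠ 0 := fun θ => by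
      simpa using hr0.ne'
    simp only [a, deriv_circleMap]
    fun_prop (disch := exact h0 _)
  have hcauchy : ∀ Y ∈ ball X (δ / 4),
      ∫ θ in Ioc 0 (2 * Real.pi), a θ * f (Y + circleMap 0 r θ • v) =
        (2 * Real.pi * Complex.I) * fderiv ℂ f Y v := by
    intro Y hY
    have hd : DifferentiableOn ℂ (fun t : ℂ => f (Y + t • v)) (closedBall 0 r) := fun t ht =>
      ((hdiff _ (hmem Y hY t ht)).comp t (f := fun t : ℂ => Y + t • v)
        (by fun_prop)).differentiableWithinAt
    have h1 := hd.circleIntegral_one_div_sub_center_pow_smul hr0 1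
    have h2 : HasDerivAt (fun t : ℂ => f (Y + t • v)) (fderiv ℂ f Y v) 0 := by
      have h3 : HasDerivAt (fun t : ℂ => Y + t • v) v 0 := by
        simpa using ((hasDerivAt_id (0 : ℂ)).smul_const v).const_add Y
      have h4 : HasFDerivAt f (fderiv ℂ f Y) (Y + (0 : ℂ) • v) := by
        simpa using (hdiff Y (by simpa using hmem Y hY 0 (by simpa using hr0.le))).hasFDerivAt
      exact h4.comp_hasDerivAt 0 h3
    rw [iteratedDeriv_one, h2.deriv, circleIntegral,
      intervalIntegral.integral_of_le (by positivity)] at h1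
    simpa [a, mul_assoc] using h1
  have hcont : ∀ Y ∈ ball X (δ / 4), Continuous fun θ : ℝ => f (Y + circleMap 0 r θ • v) :=
    fun Y hY => continuous_iff_continuousAt.2 fun θ =>
      ContinuousAt.comp (f := fun θ : ℝ => Y + circleMap 0 r θ • v)
        (hdiff _ (hmem Y hY _ (hcirc θ))).continuousAt (by fun_prop)
  have hXb : X ∈ ball X (δ / 4) := mem_ball_self (by positivity)
  have hb : ball X (δ / 4) ∈ nhds X := ball_mem_nhds _ (by positivity)
  have key := hasFDerivAt_integral_of_dominated_of_fderiv_le (𝕜 := ℂ) (x₀ := X)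
    (μ := volume.restrict (Ioc 0 (2 * Real.pi))) (s := ball X (δ / 4))
    (F := fun Y θ => a θ * f (Y + circleMap 0 r θ • v))
    (F' := fun Y θ => a θ • fderiv ℂ f (Y + circleMap 0 r θ • v))
    (bound := fun θ => ‖a θ‖ * (2 / (δ / 2))) hb
    (by
      filter_upwards [hb] with Y hY
      exact (ha.mul (hcont Y hY)).aestronglyMeasurable)
    (((ha.mul (hcont X hXb)).integrableOn_Icc).mono_set Ioc_subset_Icc_self)
    (by
      refine ha.aestronglyMeasurable.smul ?_
      refine Measurable.aestronglyMeasurable ?_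
      exact (measurable_fderiv ℂ f).comp
        (show Continuous fun θ : ℝ => X + circleMap 0 r θ • v by fun_prop).measurable)
    (Filter.Eventually.of_forall fun θ Y hY => by
      rw [norm_smul]
      exact mul_le_mul_of_nonneg_left (hbound _ (hmem Y hY _ (hcirc θ))) (norm_nonneg _))
    (((ha.norm.mul continuous_const).integrableOn_Icc).mono_set Ioc_subset_Icc_self)
    (Filter.Eventually.of_forall fun θ Y hY => by
      have h1 := (hdiff _ (hmem Y hY _ (hcirc θ))).hasFDerivAt
      have h2 : HasFDerivAt (fun Y : Mat2 => Y + circleMap 0 r θ • v) (.id ℂ Mat2) Y :=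
        (hasFDerivAt_id Y).add_const _
      exact (h1.comp Y h2).const_mul (a θ))
  have h3 : (fun Z => fderiv ℂ f Z v) =ᶠ[nhds X] fun Y => (2 * Real.pi * Complex.I)⁻¹ *
      ∫ θ in Ioc 0 (2 * Real.pi), a θ * f (Y + circleMap 0 r θ • v) := by
    filter_upwards [hb] with Y hY
    rw [hcauchy Y hY, inv_mul_cancel_left₀ Complex.two_pi_I_ne_zero]
  exact h3.differentiableAt_iff.2 (key.differentiableAt.const_mul _)

/-- The homogeneous component of degree `k` of the Taylor expansion of `f` at `0`. -/
def homComp (f : Mat2 → ℂ) (k : ℕ) (Z : Mat2) : ℂ :=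
  (k.factorial : ℂ)⁻¹ * iteratedDeriv k (fun t : ℂ => f (t • Z)) 0

theorem differentiableAt_slice {f : Mat2 → ℂ} (hf : DifferentiableOn ℂ f matBall) {Z : Mat2} {t : ℂ}
    (h : t • Z ∈ matBall) : DifferentiableAt ℂ (fun t : ℂ => f (t • Z)) t :=
  (hf.differentiableAt (isOpen_ball.mem_nhds h)).comp t (f := fun t : ℂ => t • Z) (by fun_prop)

theorem isOpen_slice (Z : Mat2) : IsOpen {t : ℂ | t • Z ∈ matBall} :=
  isOpen_ball.preimage (f := fun t : ℂ => t • Z) (by fun_prop)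

theorem analyticAt_slice {f : Mat2 → ℂ} (hf : DifferentiableOn ℂ f matBall) (Z : Mat2) :
    AnalyticAt ℂ (fun t : ℂ => f (t • Z)) 0 := by
  refine DifferentiableOn.analyticAt (s := {t : ℂ | t • Z ∈ matBall})
    (fun t ht => (differentiableAt_slice hf ht).differentiableWithinAt)
    ((isOpen_slice Z).mem_nhds ?_)
  simpa using zero_mem_ball

/-- The homogeneous components of a holomorphic function are homogeneous polynomials. -/
theorem exists_homComp_eq_eval (k : ℕ) : ∀ {f : Mat2 → ℂ}, DifferentiableOn ℂ f matBall →
    ∃ p : MvPolynomial (Fin 2 × Fin 2) ℂ, p.IsHomogeneous k ∧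
      ∀ Z : Mat2, homComp f k Z = MvPolynomial.eval (fun i => Z i.1 i.2) p := by
  -- The factorial is split off so that the induction deals with bare derivatives: one derivative
  -- along the slice is `∑ Z_i ∂_i f`, and the induction hypothesis applies to the holomorphic
  -- functions `∂_i f`.
  suffices H : ∀ {f : Mat2 → ℂ}, DifferentiableOn ℂ f matBall →
      ∃ p : MvPolynomial (Fin 2 × Fin 2) ℂ, p.IsHomogeneous k ∧ ∀ Z : Mat2,
        iteratedDeriv k (fun t : ℂ => f (t • Z)) 0 = MvPolynomial.eval (fun i => Z i.1 i.2) p by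
    intro f hf
    obtain ⟨p, hp, h⟩ := H hf
    refine ⟨MvPolynomial.C (k.factorial : ℂ)⁻¹ * p, ?_, fun Z => ?_⟩
    · simpa using (MvPolynomial.isHomogeneous_C _ _).mul hp
    · rw [homComp, h, map_mul, MvPolynomial.eval_C]
  induction k with
  | zero =>
    intro f _
    exact ⟨MvPolynomial.C (f 0), MvPolynomial.isHomogeneous_C _ _, fun Z => by simp⟩
  | succ k ih =>
    intro f hf
    let e : Fin 2 × Fin 2 → Mat2 := fun i => Pi.single i.1 (Pi.single i.2 1)
    have hZ : ∀ Z : Mat2, Z = ∑ i, Z i.1 i.2 • e i := by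
      intro Z
      ext a b
      fin_cases a <;> fin_cases b <;> simp [e, Fintype.sum_prod_type]
    choose p hp hpe using fun i => ih (differentiableOn_fderiv_apply isOpen_ball hf (e i))
    refine ⟨∑ i, p i * MvPolynomial.X i, ?_, fun Z => ?_⟩
    · exact MvPolynomial.IsHomogeneous.sum _ _ _ fun i _ =>
        (hp i).mul (MvPolynomial.isHomogeneous_X _ _)
    · have h0 : (0 : ℂ) • Z ∈ matBall := by simpa using zero_mem_ball
      have hd : deriv (fun t : ℂ => f (t • Z)) =ᶠ[nhds 0]
          fun t => ∑ i, Z i.1 i.2 * fderiv ℂ f (t • Z) (e i) := by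
        filter_upwards [(isOpen_slice Z).mem_nhds h0] with t ht
        have h1 : HasDerivAt (fun t : ℂ => t • Z) Z t := by
          simpa using (hasDerivAt_id t).smul_const Z
        have h2 := (hf.differentiableAt (isOpen_ball.mem_nhds ht)).hasFDerivAt.comp_hasDerivAt t h1
        refine h2.deriv.trans ?_
        conv_lhs => rw [hZ Z]
        rw [map_sum, ← hZ Z]
        simp
      rw [iteratedDeriv_succ', hd.iteratedDeriv_eq, iteratedDeriv_fun_sum, map_sum]
      · refine Finset.sum_congr rfl fun i _ => ?_
        rw [iteratedDeriv_const_mul_field, hpe, map_mul, MvPolynomial.eval_X, mul_comm]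
      · intro i _
        exact (analyticAt_const.mul (analyticAt_slice
          (differentiableOn_fderiv_apply isOpen_ball hf (e i)) Z)).contDiffAt

/-- The Taylor expansion along a slice. -/
theorem hasSum_homComp {f : Mat2 → ℂ} (hf : DifferentiableOn ℂ f matBall) {Z : Mat2}
    (hZ : Z ∈ closure matBall) {r : ℂ} (hr : ‖r‖ < 1) :
    HasSum (fun k => r ^ k * homComp f k Z) (f (r • Z)) := by
  have h := Complex.hasSum_taylorSeries_on_ball (c := 0) (r := 1) (z := r)
    (f := fun t : ℂ => f (t • Z)) (fun t ht => (differentiableAt_slice hf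
      (smul_mem_matBall_of_mem_closure hZ (mem_ball_zero_iff.1 ht))).differentiableWithinAt)
    (mem_ball_zero_iff.2 hr)
  refine h.congr_fun ?_
  intro k
  simp [homComp]
  ring

/-- There is no restriction on `c` or `Z`, since the component is a homogeneous polynomial on the
whole matrix space. -/
theorem homComp_smul {f : Mat2 → ℂ} (hf : DifferentiableOn ℂ f matBall) (k : ℕ) (c : ℂ) (Z : Mat2) :
    homComp f k (c • Z) = c ^ k * homComp f k Z := by
  obtain ⟨p, hp, h⟩ := exists_homComp_eq_eval k hf
  rw [h, h, MvPolynomial.eval_eq, MvPolynomial.eval_eq, Finset.mul_sum]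
  refine Finset.sum_congr rfl fun d hd => ?_
  have hk : ∑ i ∈ d.support, d i = k := by
    rw [← Finsupp.degree_apply, Finsupp.degree_eq_weight_one]
    exact hp (MvPolynomial.mem_support_iff.1 hd)
  simp only [Pi.smul_apply, smul_eq_mul, mul_pow, Finset.prod_mul_distrib]
  rw [Finset.prod_pow_eq_pow_sum, hk]
  ring

/-- Cauchy's estimate on the circle of radius `s` in the slice through `Z`. Since `s < 1`, that
circle lies in the open ball even for boundary points `Z`, so the bound is uniform on the closed
ball. -/
theorem norm_homComp_le {f : Mat2 → ℂ} (hf : DifferentiableOn ℂ f matBall) {M : ℝ}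
    (hM : ∀ Z ∈ matBall, ‖f Z‖ ≤ M) {Z : Mat2} (hZ : Z ∈ closure matBall) {s : ℝ} (hs : s ∈ Ioo 0 1)
    (k : ℕ) : ‖homComp f k Z‖ ≤ M / s ^ k := by
  have hmem : ∀ t ∈ closedBall (0 : ℂ) s, t • Z ∈ matBall := fun t ht =>
    smul_mem_matBall_of_mem_closure hZ ((mem_closedBall_zero_iff.1 ht).trans_lt hs.2)
  have hd : DiffContOnCl ℂ (fun t : ℂ => f (t • Z)) (ball 0 s) := by
    refine DifferentiableOn.diffContOnCl fun t ht => ?_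
    exact (differentiableAt_slice hf
      (hmem t (closure_ball_subset_closedBall ht))).differentiableWithinAt
  have h := Complex.norm_iteratedDeriv_le_of_forall_mem_sphere_norm_le k hs.1 hd
    fun t ht => hM _ (hmem t (sphere_subset_closedBall ht))
  rw [homComp, norm_mul, norm_inv, Complex.norm_natCast, inv_mul_le_iff₀ (by positivity)]
  exact h.trans_eq (by ring)

/-! ### Polynomial approximation on the closed ball -/

theorem polRestrict_apply (p : MvPolynomial (Fin 2 × Fin 2) ℂ) (Z : closure matBall) :
    polRestrict p Z = MvPolynomial.eval (fun i => Z.1 i.1 i.2) p := by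
  induction p using MvPolynomial.induction_on with
  | C a => simp [polRestrict]
  | add p q hp hq => simp [hp, hq]
  | mul_X p i hp =>
    rw [map_mul, ContinuousMap.mul_apply, hp, map_mul, MvPolynomial.eval_X]
    simp [polRestrict]

theorem polRestrict_mem (p : MvPolynomial (Fin 2 × Fin 2) ℂ) : polRestrict p ∈ PolClosure :=
  Subalgebra.le_topologicalClosure _ ⟨p, rfl⟩

theorem isClosed_PolClosure : IsClosed (PolClosure : Set C(closure matBall, ℂ)) :=
  Subalgebra.isClosed_topologicalClosure _

/-- A continuous function on the closed ball that is holomorphic in the interior is a uniform limit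
of polynomials. -/
theorem mem_PolClosure (g : C(closure matBall, ℂ)) {f : Mat2 → ℂ}
    (hf : DifferentiableOn ℂ f matBall) (hfg : ∀ Z (hZ : Z ∈ matBall), f Z = g ⟨Z, subset_closure hZ⟩) :
    g ∈ PolClosure := by
  -- The dilates `Z ↦ g(rZ)`. Currying makes them continuous in `r` for the sup norm, which is the
  -- uniform continuity needed to let `r` tend to `1`.
  let γ : C(closedBall (0 : ℂ) 1, C(closure matBall, ℂ)) := ContinuousMap.curry
    ⟨fun p => g ⟨p.1.1 • p.2.1, smul_mem_closure p.2.2 (mem_closedBall_zero_iff.1 p.1.2)⟩, by fun_prop⟩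
  have hγ : ∀ r (Z : closure matBall), γ r Z =
      g ⟨r.1 • Z.1, smul_mem_closure Z.2 (mem_closedBall_zero_iff.1 r.2)⟩ := fun r Z => rfl
  choose p hp hpe using fun k => exists_homComp_eq_eval k hf
  have hpe' : ∀ k (Z : closure matBall), polRestrict (p k) Z = homComp f k Z := fun k Z => by
    rw [polRestrict_apply, hpe]
  have hM : ∀ Z ∈ matBall, ‖f Z‖ ≤ ‖g‖ := fun Z hZ => by
    rw [hfg Z hZ]
    exact g.norm_coe_le_norm _
  have hmem : ∀ r : closedBall (0 : ℂ) 1, ‖r.1‖ < 1 → γ r ∈ PolClosure := by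
    intro r hr
    -- With `‖r‖ < s < 1`, Cauchy's estimate at radius `s` dominates the expansion of the dilate by
    -- a geometric series of ratio `‖r‖ / s`, uniformly on the closed ball.
    obtain ⟨s, hs1, hs2⟩ := exists_between hr
    have hs0 : 0 < s := (norm_nonneg _).trans_lt hs1
    have hsum : Summable fun k => r.1 ^ k • polRestrict (p k) := by
      refine Summable.of_norm_bounded (g := fun k => ‖g‖ * (‖r.1‖ / s) ^ k) ?_ fun k => ?_
      · exact (summable_geometric_of_lt_one (by positivity) ((div_lt_one hs0).2 hs1)).mul_left _
      · rw [norm_smul, norm_pow, div_pow, mul_div_assoc', mul_comm ‖g‖, mul_div_assoc]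
        refine mul_le_mul_of_nonneg_left ?_ (by positivity)
        refine (ContinuousMap.norm_le _ (by positivity)).2 fun Z => ?_
        rw [hpe']
        exact norm_homComp_le hf hM Z.2 ⟨hs0, hs2⟩ k
    have heq : ∑' k, r.1 ^ k • polRestrict (p k) = γ r := by
      ext Z
      rw [← ContinuousMap.tsum_apply hsum, hγ,
        ← hfg _ (smul_mem_matBall_of_mem_closure Z.2 hr), ← (hasSum_homComp hf Z.2 hr).tsum_eq]
      exact tsum_congr fun k => by rw [ContinuousMap.smul_apply, hpe', smul_eq_mul]
    rw [← heq]
    refine isClosed_PolClosure.mem_of_tendsto hsum.hasSum (Filter.Eventually.of_forall fun s => ?_)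
    exact sum_mem fun k _ => Subalgebra.smul_mem _ (polRestrict_mem _) _
  have h1 : (⟨1, by simp⟩ : closedBall (0 : ℂ) 1) ∈
      closure {r : closedBall (0 : ℂ) 1 | ‖r.1‖ < 1} := by
    have him : Subtype.val '' {r : closedBall (0 : ℂ) 1 | ‖r.1‖ < 1} = ball (0 : ℂ) 1 := by
      ext t
      simp only [mem_image, mem_ball_zero_iff]
      exact ⟨fun ⟨r, hr, h⟩ => h ▸ hr, fun h => ⟨⟨t, mem_closedBall_zero_iff.2 h.le⟩, h, rfl⟩⟩
    rw [closure_subtype, him, closure_ball _ one_ne_zero]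
    simp
  have h2 : γ ⟨1, by simp⟩ = g := by
    ext Z
    rw [hγ]
    simp
  have h3 := map_mem_closure γ.continuous h1 hmem
  rwa [h2, isClosed_PolClosure.closure_eq] at h3

/-! ### Orthogonality of different degrees by circle averaging -/

theorem integral_circle_slice {f : Mat2 → ℂ} (hf : DifferentiableOn ℂ f matBall) (k : ℕ) {Z : Mat2}
    (hZ : Z ∈ matBall) :
    ∫ θ in Ioc 0 (2 * Real.pi), f (circleMap 0 1 θ • Z) * conj (circleMap 0 1 θ ^ k) =
      2 * Real.pi * homComp f k Z := by
  have hd : DifferentiableOn ℂ (fun t : ℂ => f (t • Z)) (closedBall 0 1) := fun t ht =>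
    (differentiableAt_slice hf
      (smul_mem_matBall hZ (mem_closedBall_zero_iff.1 ht))).differentiableWithinAt
  have h := hd.circleIntegral_one_div_sub_center_pow_smul one_pos k
  rw [circleIntegral, intervalIntegral.integral_of_le (by positivity)] at h
  -- On the unit circle the inverse power in Cauchy's formula is a conjugate, and `dz / z = i dθ`.
  have h2 : ∀ θ : ℝ, deriv (circleMap 0 1) θ • (1 / (circleMap 0 1 θ - 0) ^ (k + 1)) •
      f (circleMap 0 1 θ • Z) =
      Complex.I * (f (circleMap 0 1 θ • Z) * conj (circleMap 0 1 θ ^ k)) := by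
    intro θ
    have hne : circleMap 0 1 θ ≠ 0 := circleMap_ne_center one_ne_zero
    have hn : ‖circleMap 0 1 θ‖ = 1 := by simp
    have hc : conj (circleMap 0 1 θ) = (circleMap 0 1 θ)⁻¹ := by
      rw [Complex.inv_def, Complex.normSq_eq_norm_sq, hn]
      simp
    rw [map_pow, hc, deriv_circleMap, smul_eq_mul, smul_eq_mul, sub_zero, pow_succ, inv_pow]
    field_simp
  simp only [h2] at h
  rw [integral_const_mul] at h
  refine mul_left_cancel₀ Complex.I_ne_zero (h.trans ?_)
  rw [homComp, smul_eq_mul]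
  ring

/-- Against a function that is homogeneous of degree `k`, only the homogeneous component of degree
`k` contributes. -/
theorem integral_mul_conj_of_homogeneous (lam : ℕ) {f q : Mat2 → ℂ}
    (hf : DifferentiableOn ℂ f matBall) {k : ℕ} (hq : ∀ (c : ℂ) Z, q (c • Z) = c ^ k * q Z)
    (hint : Integrable (fun Z => f Z * conj (q Z)) (mu lam)) :
    ∫ Z, f Z * conj (q Z) ∂(mu lam) = ∫ Z, homComp f k Z * conj (q Z) ∂(mu lam) := by
  let ν : Measure ℝ := volume.restrict (Ioc 0 (2 * Real.pi))
  have hν : ν.real univ = 2 * Real.pi := by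
    simp [ν, Measure.real, Real.pi_pos.le]
  let G : Mat2 → ℂ := fun Z => f Z * conj (q Z)
  -- Rotating `Z` by the angle recorded in the first factor preserves the product measure. The
  -- integral of the rotated integrand is then computed twice: by this invariance (`h1`), and by
  -- integrating over the angle first, which extracts the degree `k` component (`h3`).
  have hT : MeasurePreserving (fun x : ℝ × Mat2 => (x.1, circleMap 0 1 x.1 • x.2))
      (ν.prod (mu lam)) (ν.prod (mu lam)) := by
    refine (MeasurePreserving.id ν).skew_product (g := fun θ Z => circleMap 0 1 θ • Z) ?_ ?_
    · exact Continuous.measurable (by unfold Function.uncurry; fun_prop)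
    · exact Filter.Eventually.of_forall fun θ => (measurePreserving_smul_mu lam (by simp)).map_eq
  have hG : Integrable (fun x : ℝ × Mat2 => G x.2) (ν.prod (mu lam)) := hint.comp_snd ν
  have hGT : Integrable (fun x : ℝ × Mat2 => G (circleMap 0 1 x.1 • x.2)) (ν.prod (mu lam)) :=
    hT.integrable_comp_of_integrable hG
  have h1 : ∫ x, G (circleMap 0 1 x.1 • x.2) ∂(ν.prod (mu lam)) = 2 * Real.pi * ∫ Z, G Z ∂(mu lam) := by
    have h2 := integral_map (μ := ν.prod (mu lam)) hT.measurable.aemeasurable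
      (f := fun x : ℝ × Mat2 => G x.2) (by rw [hT.map_eq]; exact hG.aestronglyMeasurable)
    rw [hT.map_eq] at h2
    rw [← h2, integral_fun_snd, hν]
    simp
  have h3 : ∫ x, G (circleMap 0 1 x.1 • x.2) ∂(ν.prod (mu lam)) =
      2 * Real.pi * ∫ Z, homComp f k Z * conj (q Z) ∂(mu lam) := by
    rw [integral_prod_symm _ hGT, ← integral_const_mul]
    refine integral_congr_ae ?_
    filter_upwards [ae_mem_matBall lam] with Z hZ
    rw [← mul_assoc, ← integral_circle_slice hf k hZ, ← integral_mul_const]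
    refine integral_congr_ae (Filter.Eventually.of_forall fun θ => ?_)
    simp only [G, hq, map_mul]
    ring
  have h4 : (2 * Real.pi : ℂ) ≠ 0 := by
    simp [Real.pi_ne_zero]
  exact mul_left_cancel₀ h4 (h1.symm.trans h3)

/-! ### Operators with a symbol -/

section

theorem memLp_one (lam : ℕ) : MemLp (fun _ : Mat2 => (1 : ℂ)) 2 (mu lam) := memLp_const 1

/-- The vector of `H` represented by the constant function `1`. -/
def oneVec (lam : ℕ) : Hilb lam :=
  (⟨(memLp_one lam).toLp, fun _ => 1, differentiableOn_const 1, by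
    filter_upwards [MemLp.coeFn_toLp (memLp_one lam)] with Z h
    rw [h, map_one]⟩ : hilbertSubmodule lam)

variable (lam : ℕ) [Fact (3 < lam)]

theorem holRep_oneVec {Z : Mat2} (hZ : Z ∈ matBall) : holRep lam (oneVec lam) Z = 1 := by
  refine holRep_eqOn lam (oneVec lam) (φ := fun _ => 1) (differentiableOn_const 1) ?_ hZ
  filter_upwards [MemLp.coeFn_toLp (memLp_one lam)] with Z h
  exact h.trans (map_one _).symm

/-- Pairing with the constant function `1` normalizes the coherent states: they cannot vanish, and
eigenvalues on them can be read off. -/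
theorem inner_oneVec_coh (Z : matBall) : ⟪oneVec lam, coh lam Z⟫_ℂ = 1 := by
  rw [inner_coh_right, holRep_oneVec lam Z.2]

theorem coh_ne_zero (Z : matBall) : coh lam Z ≠ 0 := fun h => by
  have := inner_oneVec_coh lam Z
  rw [h, inner_zero_right] at this
  exact zero_ne_one this

theorem smul_coh_injective (Z : matBall) {a b : ℂ} (h : a • coh lam Z = b • coh lam Z) : a = b :=
  smul_left_injective ℂ (coh_ne_zero lam Z) h

theorem norm_eigenvalue_le {A : Hilb lam →L[ℂ] Hilb lam} {Z : matBall} {c : ℂ}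
    (h : A (coh lam Z) = c • coh lam Z) : ‖c‖ ≤ ‖A‖ := by
  have h1 := A.le_opNorm (coh lam Z)
  rw [h, norm_smul] at h1
  exact le_of_mul_le_mul_right h1 (norm_pos_iff.2 (coh_ne_zero lam Z))

/-- Passing to the adjoint keeps the norm, and multiplication by `conj f` on `L²` is bounded by the
supremum of `|f|`. -/
theorem norm_annih_le {f : Mat2 → ℂ} (hf : IsHInf f) {C : ℝ} (hC : ∀ Z ∈ matBall, ‖f Z‖ ≤ C) :
    ‖annih lam hf‖ ≤ C := by
  have hC0 : 0 ≤ C := (norm_nonneg _).trans (hC 0 zero_mem_ball)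
  rw [annih, LinearIsometryEquiv.norm_map]
  refine ContinuousLinearMap.opNorm_le_bound _ hC0 fun ψ => ?_
  refine Lp.norm_le_mul_norm_of_ae_le_mul (f := (conjMulFun lam hf ψ).toLp) (g := ψ.toLp) ?_
  filter_upwards [ae_mem_matBall lam, coeFn_conjMulFun lam hf ψ] with Z hZ h1
  rw [h1, norm_mul, RCLike.norm_conj]
  exact mul_le_mul_of_nonneg_right (hC Z hZ) (norm_nonneg _)

/-- `g` is the symbol of `A`: the coherent states are eigenvectors of `A` with eigenvalues given by
`g`. -/
def IsSymbol (A : Hilb lam →L[ℂ] Hilb lam) (g : C(closure matBall, ℂ)) : Prop :=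
  ∀ Z : matBall, A (coh lam Z) = g ⟨Z, subset_closure Z.2⟩ • coh lam Z

variable {lam}

theorem norm_le_of_matBall {g : C(closure matBall, ℂ)} {C : ℝ}
    (h : ∀ Z : matBall, ‖g ⟨Z, subset_closure Z.2⟩‖ ≤ C) : ‖g‖ ≤ C := by
  refine (ContinuousMap.norm_le _ ((norm_nonneg _).trans (h ⟨0, zero_mem_ball⟩))).2 fun Z => ?_
  have hc : IsClosed {Z | ‖g Z‖ ≤ C} := isClosed_le (by fun_prop) continuous_const
  have hd : Z ∈ closure {Z : closure matBall | Z.1 ∈ matBall} := by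
    rw [closure_subtype]
    have : Subtype.val '' {Z : closure matBall | Z.1 ∈ matBall} = matBall := by
      ext W
      exact ⟨fun ⟨V, hV, h⟩ => h ▸ hV, fun hW => ⟨⟨W, subset_closure hW⟩, hW, rfl⟩⟩
    rw [this]
    exact Z.2
  exact hc.closure_subset_iff.2 (fun (W : closure matBall) hW => h ⟨W.1, hW⟩) hd

namespace IsSymbol

variable {A B : Hilb lam →L[ℂ] Hilb lam} {g h : C(closure matBall, ℂ)}

theorem op_unique (hA : IsSymbol lam A g) (hB : IsSymbol lam B g) : A = B :=
  ext_coh lam fun Z => (hA Z).trans (hB Z).symm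

theorem add (hA : IsSymbol lam A g) (hB : IsSymbol lam B h) : IsSymbol lam (A + B) (g + h) :=
  fun Z => by rw [add_apply, hA, hB, ContinuousMap.add_apply, add_smul]

theorem sub (hA : IsSymbol lam A g) (hB : IsSymbol lam B h) : IsSymbol lam (A - B) (g - h) :=
  fun Z => by rw [sub_apply, hA, hB, ContinuousMap.sub_apply, sub_smul]

theorem mul (hA : IsSymbol lam A g) (hB : IsSymbol lam B h) : IsSymbol lam (A * B) (g * h) :=
  fun Z => by
    rw [mul_apply_eq_comp, hB, map_smul, hA, smul_smul, ContinuousMap.mul_apply, mul_comm]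

theorem algebraMap (c : ℂ) :
    IsSymbol lam (algebraMap ℂ _ c) (algebraMap ℂ C(closure matBall, ℂ) c) := fun Z => by
  simp [Algebra.algebraMap_eq_smul_one]

/-- An operator with a symbol is the annihilation operator of a holomorphic function. -/
theorem exists_eq_annih (hA : IsSymbol lam A g) : ∃ (f : Mat2 → ℂ) (hf : IsHInf f),
    (∀ Z (hZ : Z ∈ matBall), f Z = g ⟨Z, subset_closure hZ⟩) ∧ A = annih lam hf := by
  -- The holomorphic function is the one represented by `A* 1`: `⟨A* 1 | Z⟩ = ⟨1 | A Z⟩ = g(Z) ⟨1 |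
  -- Z⟩ = g(Z)`.
  have h1 : ∀ Z (hZ : Z ∈ matBall),
      holRep lam (ContinuousLinearMap.adjoint A (oneVec lam)) Z = g ⟨Z, subset_closure hZ⟩ := by
    intro Z hZ
    rw [← inner_coh_right lam _ ⟨Z, hZ⟩, ContinuousLinearMap.adjoint_inner_left, hA,
      inner_smul_right, inner_oneVec_coh, mul_one]
  refine ⟨_, ⟨differentiableOn_holRep lam _, ‖g‖, fun Z hZ => ?_⟩, h1,
    (isAnnihilation_iff lam _ A).1 fun Z => ?_⟩
  · rw [h1 Z hZ]
    exact g.norm_coe_le_norm _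
  · rw [hA, h1 Z Z.2]

/-- This isometry carries limits between operators and symbols in both directions, and yields
uniqueness of symbols. -/
theorem norm_eq (hA : IsSymbol lam A g) : ‖A‖ = ‖g‖ := by
  refine le_antisymm ?_ (norm_le_of_matBall fun Z => norm_eigenvalue_le lam (hA Z))
  obtain ⟨f, hf, h, rfl⟩ := hA.exists_eq_annih
  exact norm_annih_le lam hf fun Z hZ => h Z hZ ▸ g.norm_coe_le_norm _

theorem symbol_unique (hg : IsSymbol lam A g) (hh : IsSymbol lam A h) : g = h := by
  have h0 := (hg.sub hh).norm_eq
  rw [sub_self, norm_zero] at h0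
  exact sub_eq_zero.1 (norm_eq_zero.1 h0.symm)

/-- Having a continuous symbol already forces holomorphy inside the ball, so the approximation
theorem applies. -/
theorem mem_PolClosure (hA : IsSymbol lam A g) : g ∈ PolClosure := by
  obtain ⟨f, hf, h, -⟩ := hA.exists_eq_annih
  exact MatrixBall.mem_PolClosure g hf.1 h

theorem of_tendsto {a : ℕ → Hilb lam →L[ℂ] Hilb lam} {s : ℕ → C(closure matBall, ℂ)}
    (h : ∀ n, IsSymbol lam (a n) (s n)) (ha : Filter.Tendsto a Filter.atTop (nhds A))
    (hs : Filter.Tendsto s Filter.atTop (nhds g)) : IsSymbol lam A g := fun Z => by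
  have h1 : Filter.Tendsto (fun n => a n (coh lam Z)) Filter.atTop (nhds (A (coh lam Z))) :=
    ((ContinuousLinearMap.apply ℂ (Hilb lam) (coh lam Z)).continuous.tendsto A).comp ha
  have h2 : Filter.Tendsto (fun n => s n ⟨Z, subset_closure Z.2⟩ • coh lam Z) Filter.atTop
      (nhds (g ⟨Z, subset_closure Z.2⟩ • coh lam Z)) :=
    (((continuous_eval_const (F := C(closure matBall, ℂ)) _).tendsto g).comp hs).smul_const _
  exact tendsto_nhds_unique h1 (h2.congr fun n => (h n Z).symm)

end IsSymbol

/-! ### The isometric isomorphism with the closure of the polynomials -/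

theorem isSymbol_coordOp (k l : Fin 2) :
    IsSymbol lam (coordOp lam k l) (polRestrict (MvPolynomial.X (k, l))) := fun Z => by
  rw [polRestrict_apply, MvPolynomial.eval_X]
  exact isAnnihilation_annih lam (isHInf_coord k l) Z

theorem exists_mem_adjoin_isSymbol (p : MvPolynomial (Fin 2 × Fin 2) ℂ) :
    ∃ A ∈ Algebra.adjoin ℂ (Set.range fun p : Fin 2 × Fin 2 => coordOp lam p.1 p.2),
      IsSymbol lam A (polRestrict p) := by
  induction p using MvPolynomial.induction_on with
  | C c =>
    refine ⟨_, Subalgebra.algebraMap_mem _ c, ?_⟩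
    rw [← MvPolynomial.algebraMap_eq, AlgHom.commutes]
    exact IsSymbol.algebraMap c
  | add p q hp hq =>
    obtain ⟨A, hA, hAp⟩ := hp
    obtain ⟨B, hB, hBq⟩ := hq
    exact ⟨A + B, add_mem hA hB, map_add polRestrict p q ▸ hAp.add hBq⟩
  | mul_X p i hp =>
    obtain ⟨A, hA, hAp⟩ := hp
    exact ⟨A * coordOp lam i.1 i.2, mul_mem hA (Algebra.subset_adjoin ⟨i, rfl⟩),
      map_mul polRestrict p _ ▸ hAp.mul (isSymbol_coordOp i.1 i.2)⟩

theorem exists_isSymbol_of_mem_adjoin {A : Hilb lam →L[ℂ] Hilb lam}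
    (hA : A ∈ Algebra.adjoin ℂ (Set.range fun p : Fin 2 × Fin 2 => coordOp lam p.1 p.2)) :
    ∃ p, IsSymbol lam A (polRestrict p) := by
  induction hA using Algebra.adjoin_induction with
  | mem A hA =>
    obtain ⟨i, rfl⟩ := hA
    exact ⟨_, isSymbol_coordOp i.1 i.2⟩
  | algebraMap c =>
    refine ⟨_, (?_ : IsSymbol lam _ (polRestrict (algebraMap ℂ _ c)))⟩
    rw [AlgHom.commutes]
    exact IsSymbol.algebraMap c
  | add A B _ _ hA hB =>
    obtain ⟨p, hp⟩ := hA
    obtain ⟨q, hq⟩ := hB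
    exact ⟨p + q, map_add polRestrict p q ▸ hp.add hq⟩
  | mul A B _ _ hA hB =>
    obtain ⟨p, hp⟩ := hA
    obtain ⟨q, hq⟩ := hB
    exact ⟨p * q, map_mul polRestrict p q ▸ hp.mul hq⟩

/-- Approximating elements of the generated algebra have polynomial symbols, which form a Cauchy
sequence by the isometry; `exists_op` runs the same argument backwards. -/
theorem exists_isSymbol {A : Hilb lam →L[ℂ] Hilb lam} (hA : A ∈ Ppol lam) :
    ∃ g, IsSymbol lam A g := by
  obtain ⟨a, ha, hlim⟩ := mem_closure_iff_seq_limit.1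
    (show A ∈ closure (Algebra.adjoin ℂ
      (Set.range fun p : Fin 2 × Fin 2 => coordOp lam p.1 p.2) : Set _) from hA)
  choose p hp using fun n => exists_isSymbol_of_mem_adjoin (ha n)
  have hc : CauchySeq fun n => polRestrict (p n) := by
    refine Metric.cauchySeq_iff.2 fun ε hε => ?_
    obtain ⟨N, hN⟩ := Metric.cauchySeq_iff.1 hlim.cauchySeq ε hε
    refine ⟨N, fun m hm n hn => ?_⟩
    rw [dist_eq_norm, ← ((hp m).sub (hp n)).norm_eq, ← dist_eq_norm]
    exact hN m hm n hn
  obtain ⟨g, hg⟩ := cauchySeq_tendsto_of_complete hc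
  exact ⟨g, IsSymbol.of_tendsto hp hlim hg⟩

variable (lam) in
theorem exists_op {g : C(closure matBall, ℂ)} (hg : g ∈ PolClosure) :
    ∃ A ∈ Ppol lam, IsSymbol lam A g := by
  obtain ⟨s, hs, hlim⟩ := mem_closure_iff_seq_limit.1
    (show g ∈ closure (polRestrict.range : Set _) from hg)
  choose p hp using hs
  choose a ha hap using fun n => exists_mem_adjoin_isSymbol (lam := lam) (p n)
  have has : ∀ n, IsSymbol lam (a n) (s n) := fun n => hp n ▸ hap n
  have hc : CauchySeq a := by
    refine Metric.cauchySeq_iff.2 fun ε hε => ?_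
    obtain ⟨N, hN⟩ := Metric.cauchySeq_iff.1 hlim.cauchySeq ε hε
    refine ⟨N, fun m hm n hn => ?_⟩
    rw [dist_eq_norm, ((has m).sub (has n)).norm_eq, ← dist_eq_norm]
    exact hN m hm n hn
  obtain ⟨A, hA⟩ := cauchySeq_tendsto_of_complete hc
  exact ⟨A, mem_closure_of_tendsto hA (Filter.Eventually.of_forall ha),
    IsSymbol.of_tendsto has hA hlim⟩

/-- The symbol is a limit of polynomials, hence the symbol of some operator in `Ppol`, and an
operator is determined by its symbol. -/
theorem IsSymbol.mem_Ppol {A : Hilb lam →L[ℂ] Hilb lam} {g : C(closure matBall, ℂ)}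
    (h : IsSymbol lam A g) : A ∈ Ppol lam := by
  obtain ⟨B, hB, hBg⟩ := exists_op lam h.mem_PolClosure
  exact h.op_unique hBg ▸ hB

variable (lam) in
/-- The operator in `P⁺⁺_pol` with a given symbol. -/
def opOfSymbol (g : PolClosure) : Ppol lam :=
  ⟨(exists_op lam g.2).choose, (exists_op lam g.2).choose_spec.1⟩

theorem isSymbol_opOfSymbol (g : PolClosure) : IsSymbol lam (opOfSymbol lam g).1 g.1 :=
  (exists_op lam g.2).choose_spec.2

variable (lam) in
/-- The isomorphism `f ↦ a(f)` of the closure of the polynomials onto `P⁺⁺_pol`. -/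
def symbolEquiv : PolClosure ≃ₐ[ℂ] Ppol lam :=
  AlgEquiv.ofBijective
    { toFun := opOfSymbol lam
      map_one' := Subtype.ext ((isSymbol_opOfSymbol 1).op_unique fun Z => by simp)
      map_mul' := fun g h => Subtype.ext ((isSymbol_opOfSymbol (g * h)).op_unique
        ((isSymbol_opOfSymbol g).mul (isSymbol_opOfSymbol h)))
      map_zero' := Subtype.ext ((isSymbol_opOfSymbol 0).op_unique fun Z => by simp)
      map_add' := fun g h => Subtype.ext ((isSymbol_opOfSymbol (g + h)).op_unique
        ((isSymbol_opOfSymbol g).add (isSymbol_opOfSymbol h)))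
      commutes' := fun c => Subtype.ext ((isSymbol_opOfSymbol (algebraMap ℂ _ c)).op_unique
        (IsSymbol.algebraMap c)) }
    ⟨fun g h hgh => Subtype.ext ((isSymbol_opOfSymbol g).symbol_unique
        ((congrArg Subtype.val hgh : (opOfSymbol lam g).1 = (opOfSymbol lam h).1) ▸
          isSymbol_opOfSymbol h)),
      fun A => by
        obtain ⟨g, hg⟩ := exists_isSymbol A.2
        exact ⟨⟨g, hg.mem_PolClosure⟩, Subtype.ext ((isSymbol_opOfSymbol _).op_unique hg)⟩⟩

theorem isSymbol_symbolEquiv (g : PolClosure) : IsSymbol lam (symbolEquiv lam g).1 g.1 :=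
  isSymbol_opOfSymbol g

theorem norm_symbolEquiv (g : PolClosure) : ‖symbolEquiv lam g‖ = ‖g‖ :=
  (isSymbol_symbolEquiv g).norm_eq

/-- Coherent states are nonzero, so the symbol of `a(f)` agrees with `f` on the ball and is the
extension; conversely a continuous extension is a symbol. -/
theorem annih_mem_Ppol_iff {f : Mat2 → ℂ} (hf : IsHInf f) : annih lam hf ∈ Ppol lam ↔
    ∃ g : Mat2 → ℂ, ContinuousOn g (closure matBall) ∧ EqOn g f matBall := by
  constructor
  · intro h
    obtain ⟨g, hg⟩ := exists_isSymbol h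
    classical
    refine ⟨fun Z => if hZ : Z ∈ closure matBall then g ⟨Z, hZ⟩ else 0, ?_, fun Z hZ => ?_⟩
    · rw [continuousOn_iff_continuous_domRestrict]
      convert g.continuous using 1
      ext Z
      simp
    · have h1 := (hg ⟨Z, hZ⟩).symm.trans (isAnnihilation_annih lam hf ⟨Z, hZ⟩)
      simp only [subset_closure hZ, dite_true]
      exact smul_coh_injective lam _ h1
  · rintro ⟨g, hg, hgf⟩
    refine IsSymbol.mem_Ppol (g := ⟨_, hg.domRestrict⟩) fun Z => ?_
    rw [isAnnihilation_annih lam hf, ← hgf Z.2]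
    rfl

end

/-! ### The inner product as an integral of holomorphic functions -/

section

theorem integrable_holRep_mul_conj {lam : ℕ} (φ ψ : Hilb lam) :
    Integrable (fun Z => holRep lam φ Z * conj (holRep lam ψ Z)) (mu lam) := by
  refine (L2.integrable_inner (𝕜 := ℂ) φ.toLp ψ.toLp).congr ?_
  filter_upwards [coeFn_ae_eq lam φ, coeFn_ae_eq lam ψ] with Z h1 h2
  rw [h1, h2, RCLike.inner_apply, Complex.conj_conj, mul_comm]

/-- The conjugate falls on the second function because vectors of `H` are conjugates of their
holomorphic representatives. -/
theorem inner_eq_integral {lam : ℕ} (φ ψ : Hilb lam) :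
    ⟪φ, ψ⟫_ℂ = ∫ Z, holRep lam φ Z * conj (holRep lam ψ Z) ∂(mu lam) := by
  refine (L2.inner_def (𝕜 := ℂ) φ.toLp ψ.toLp).trans (integral_congr_ae ?_)
  filter_upwards [coeFn_ae_eq lam φ, coeFn_ae_eq lam ψ] with Z h1 h2
  rw [h1, h2, RCLike.inner_apply, Complex.conj_conj, mul_comm]

/-- The pairing with a homogeneous vector only sees one homogeneous component. -/
theorem inner_eq_integral_homComp {lam : ℕ} (φ ψ : Hilb lam) {q : Mat2 → ℂ} {k : ℕ}
    (hq : ∀ (c : ℂ) Z, q (c • Z) = c ^ k * q Z) (hψ : EqOn (holRep lam ψ) q matBall) :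
    ⟪φ, ψ⟫_ℂ = ∫ Z, homComp (holRep lam φ) k Z * conj (q Z) ∂(mu lam) := by
  have h : (fun Z => holRep lam φ Z * conj (holRep lam ψ Z)) =ᵐ[mu lam]
      fun Z => holRep lam φ Z * conj (q Z) := by
    filter_upwards [ae_mem_matBall lam] with Z hZ
    rw [hψ hZ]
  rw [inner_eq_integral, integral_congr_ae h]
  exact integral_mul_conj_of_homogeneous lam (differentiableOn_holRep lam φ) hq
    ((integrable_holRep_mul_conj φ ψ).congr h)

variable {lam : ℕ} [Fact (3 < lam)]

/-! ### Characters and the maximal ideal space -/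

instance : CompleteSpace (Ppol lam) :=
  (Subalgebra.isClosed_topologicalClosure _).completeSpace_coe

theorem continuous_symbolEquiv : Continuous (symbolEquiv lam) :=
  (AddMonoidHomClass.isometry_of_norm (symbolEquiv lam) norm_symbolEquiv).continuous

variable (lam) in
/-- The character of `P⁺⁺_pol` given by evaluating the symbol at a point of the closed ball. -/
def evalChar (Z : closure matBall) : Ppol lam →ₐ[ℂ] ℂ :=
  ((ContinuousMap.evalAlgHom ℂ ℂ Z).comp PolClosure.val).comp (symbolEquiv lam).symm.toAlgHom

theorem evalChar_apply (Z : closure matBall) (A : Ppol lam) :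
    evalChar lam Z A = ((symbolEquiv lam).symm A).1 Z := rfl

theorem evalChar_symbolEquiv (Z : closure matBall) (g : PolClosure) :
    evalChar lam Z (symbolEquiv lam g) = g.1 Z := by
  rw [evalChar_apply, AlgEquiv.symm_apply_apply]

variable (lam) in
/-- The operator with a given polynomial symbol. -/
def polOp : MvPolynomial (Fin 2 × Fin 2) ℂ →ₐ[ℂ] Ppol lam :=
  (symbolEquiv lam).toAlgHom.comp (polRestrict.codRestrict PolClosure polRestrict_mem)

theorem polOp_apply (p : MvPolynomial (Fin 2 × Fin 2) ℂ) :
    polOp lam p = symbolEquiv lam ⟨polRestrict p, polRestrict_mem p⟩ := rfl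

theorem isSymbol_polOp (p : MvPolynomial (Fin 2 × Fin 2) ℂ) :
    IsSymbol lam (polOp lam p).1 (polRestrict p) := isSymbol_symbolEquiv _

theorem polOp_X (k l : Fin 2) :
    polOp lam (MvPolynomial.X (k, l)) = ⟨coordOp lam k l, coordOp_mem_Ppol lam k l⟩ :=
  Subtype.ext ((isSymbol_polOp _).op_unique (isSymbol_coordOp k l))

theorem evalChar_polOp (Z : closure matBall) (p : MvPolynomial (Fin 2 × Fin 2) ℂ) :
    evalChar lam Z (polOp lam p) = MvPolynomial.eval (fun i => Z.1 i.1 i.2) p := by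
  rw [polOp_apply, evalChar_symbolEquiv, polRestrict_apply]

theorem denseRange_polOp : DenseRange (polOp lam) := by
  have h : DenseRange (polRestrict.codRestrict PolClosure polRestrict_mem) := by
    intro g
    rw [closure_subtype, ← range_comp]
    exact g.2
  exact (symbolEquiv lam).surjective.denseRange.comp h continuous_symbolEquiv

theorem norm_algHom_apply_le (χ : Ppol lam →ₐ[ℂ] ℂ) (A : Ppol lam) : ‖χ A‖ ≤ ‖A‖ := by
  have h1 : ‖(1 : Ppol lam)‖ ≤ 1 := ContinuousLinearMap.norm_id_le
  exact (AlgHom.norm_apply_le_self_mul_norm_one χ A).trans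
    (mul_le_of_le_one_right (norm_nonneg _) h1)

/-- Every character of `P⁺⁺_pol` is the evaluation at a point of the closed ball. -/
theorem exists_eq_evalChar (χ : Ppol lam →ₐ[ℂ] ℂ) : ∃ Z, χ = evalChar lam Z := by
  let W : Mat2 := fun k l => χ (polOp lam (MvPolynomial.X (k, l)))
  have hW : ∀ p, χ (polOp lam p) = MvPolynomial.eval (fun i => W i.1 i.2) p := by
    have : χ.comp (polOp lam) = MvPolynomial.aeval fun i => W i.1 i.2 :=
      MvPolynomial.algHom_ext fun i => by simp [W]
    intro p
    rw [← MvPolynomial.coe_aeval_eq_eval]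
    exact DFunLike.congr_fun this p
  -- Otherwise a separating functional is a linear polynomial `p` with `|χ(p)| = |p(W)| > M`,
  -- although `‖p‖ ≤ M` on the ball and `χ` is contractive.
  have hmem : W ∈ closure matBall := by
    by_contra hn
    obtain ⟨c, M, h1, h2⟩ := exists_separating hn
    let p : MvPolynomial (Fin 2 × Fin 2) ℂ :=
      ∑ k, ∑ l, MvPolynomial.C (c k l) * MvPolynomial.X (k, l)
    have hp : ∀ Z : Mat2, MvPolynomial.eval (fun i => Z i.1 i.2) p = ∑ k, ∑ l, c k l * Z k l := by
      intro Z
      simp only [p, map_sum, map_mul, MvPolynomial.eval_C, MvPolynomial.eval_X]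
    have h3 : ‖polOp lam p‖ ≤ M := by
      rw [polOp_apply]
      refine (norm_symbolEquiv _).trans_le
        (norm_le_of_matBall (g := polRestrict p) fun Z => ?_)
      rw [polRestrict_apply, hp]
      exact h1 _ (subset_closure Z.2)
    have h4 := norm_algHom_apply_le χ (polOp lam p)
    rw [hW, hp] at h4
    linarith
  refine ⟨⟨W, hmem⟩, ?_⟩
  have hc : Continuous χ := AddMonoidHomClass.continuous_of_bound χ 1 fun A => by
    rw [one_mul]
    exact norm_algHom_apply_le χ A
  have hc' : Continuous (evalChar lam ⟨W, hmem⟩) :=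
    AddMonoidHomClass.continuous_of_bound _ 1 fun A => by
      rw [one_mul]
      exact norm_algHom_apply_le _ A
  have := denseRange_polOp (lam := lam).equalizer hc hc' (funext fun p => by
    simp only [Function.comp_apply, hW, evalChar_polOp])
  exact DFunLike.coe_injective this

theorem evalChar_injective : Function.Injective (evalChar lam) := fun Z W h => by
  ext k l
  have := DFunLike.congr_fun h (polOp lam (MvPolynomial.X (k, l)))
  simpa [evalChar_polOp] using this

variable (lam) in
/-- The point of the maximal ideal space of `P⁺⁺_pol` given by a point of the closed ball. -/
def evalPoint (Z : closure matBall) : WeakDual.characterSpace ℂ (Ppol lam) :=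
  WeakDual.CharacterSpace.equivAlgHom.symm (evalChar lam Z)

theorem evalPoint_apply (Z : closure matBall) (A : Ppol lam) :
    evalPoint lam Z A = evalChar lam Z A := rfl

theorem continuous_evalPoint : Continuous (evalPoint lam) :=
  Continuous.subtype_mk (WeakDual.continuous_of_continuous_eval fun A =>
    ((symbolEquiv lam).symm A).1.continuous) _

theorem bijective_evalPoint : Function.Bijective (evalPoint lam) := by
  refine ⟨fun Z W h => evalChar_injective (lam := lam) (AlgHom.ext fun A => ?_), fun χ => ?_⟩
  · rw [← evalPoint_apply, h, evalPoint_apply]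
  · obtain ⟨Z, hZ⟩ := exists_eq_evalChar (lam := lam) (WeakDual.CharacterSpace.equivAlgHom χ)
    exact ⟨Z, by rw [evalPoint, ← hZ, Equiv.symm_apply_apply]⟩

/-- Evaluation is a continuous bijection from the compact ball to a Hausdorff space; the map sought
is its inverse. -/
theorem exists_homeomorph : ∃ e : WeakDual.characterSpace ℂ (Ppol lam) ≃ₜ closure matBall,
    ∀ χ k l, (e χ : Mat2) k l = χ ⟨coordOp lam k l, coordOp_mem_Ppol lam k l⟩ := by
  let e : closure matBall ≃ₜ WeakDual.characterSpace ℂ (Ppol lam) :=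
    Continuous.homeoOfEquivCompactToT2 (f := Equiv.ofBijective _ bijective_evalPoint)
      continuous_evalPoint
  refine ⟨e.symm, fun χ k l => ?_⟩
  obtain ⟨Z, rfl⟩ := e.surjective χ
  rw [Homeomorph.symm_apply_apply]
  change _ = evalPoint lam Z _
  rw [evalPoint_apply, ← polOp_X, evalChar_polOp, MvPolynomial.eval_X]

/-! ### Semisimplicity -/

theorem jacobson_Ppol : Ring.jacobson (Ppol lam) = ⊥ := by
  refine (Submodule.eq_bot_iff _).2 fun A hA => ?_
  have h : ∀ Z, evalChar lam Z A = 0 := by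
    intro Z
    have hmax : (RingHom.ker (evalChar lam Z)).IsMaximal :=
      RingHom.ker_isMaximal_of_surjective _ fun z => ⟨algebraMap ℂ _ z, by simp⟩
    exact (sInf_le hmax.out : Ring.jacobson (Ppol lam) ≤ _) hA
  refine (symbolEquiv lam).symm.injective ?_
  rw [map_zero]
  exact Subtype.ext (ContinuousMap.ext h)

theorem eq_zero_of_forall_isUnit {p : Hilb lam →L[ℂ] Hilb lam} (hp : p ∈ Ppol lam)
    (h : ∀ c : ℂ, IsUnit (1 + c • p)) : p = 0 := by
  obtain ⟨g, hg⟩ := exists_isSymbol hp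
  refine ext_coh lam fun Z => ?_
  by_cases h0 : g ⟨Z, subset_closure Z.2⟩ = 0
  · rw [hg, h0, zero_smul, zero_apply]
  · exfalso
    -- For `c = -1/g(Z)` the operator `1 + c p` annihilates the coherent state at `Z`, so it has no
    -- left inverse.
    obtain ⟨B, hB⟩ := (h (-(g ⟨Z, subset_closure Z.2⟩)⁻¹)).exists_left_inv
    have h1 : (1 + -(g ⟨Z, subset_closure Z.2⟩)⁻¹ • p) (coh lam Z) = 0 := by
      rw [add_apply, one_apply_eq_self, smul_apply, hg Z, smul_smul, neg_mul, inv_mul_cancel₀ h0,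
        neg_smul, one_smul, add_neg_cancel]
    refine coh_ne_zero lam Z ?_
    rw [← one_apply_eq_self (F := Hilb lam →L[ℂ] Hilb lam) (coh lam Z), ← hB, mul_apply_eq_comp, h1,
      map_zero]

/-! ### The inclusion in `Ppp` is proper -/

theorem norm_apply_lt_one {Z : Mat2} (hZ : Z ∈ matBall) (k l : Fin 2) : ‖Z k l‖ < 1 := by
  have h := mem_matBall_iff.1 hZ (EuclideanSpace.single l 1) (by simp)
  have h2 := PiLp.norm_apply_le (act Z (EuclideanSpace.single l 1)) k
  have h3 : act Z (EuclideanSpace.single l 1) k = Z k l := by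
    simp [act_apply]
  rw [PiLp.norm_single, norm_one] at h
  rw [h3] at h2
  exact h2.trans_lt h

/-- The matrix unit `E₁₁`, a boundary point of the ball. -/
def matUnit : Mat2 := Pi.single 0 (Pi.single 0 1)

theorem matUnit_mem : matUnit ∈ closure matBall := by
  refine mem_closure_matBall fun v => ?_
  have h : act matUnit v = EuclideanSpace.single 0 (v 0) := by
    ext k
    fin_cases k <;> simp [act_apply, matUnit]
  rw [h, PiLp.norm_single]
  exact PiLp.norm_apply_le v 0

/-- A bounded holomorphic function without a continuous extension to the closed ball. -/
def singularInner (Z : Mat2) : ℂ := Complex.exp ((Z 0 0 + 1) / (Z 0 0 - 1))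

/-- The map `z ↦ (z + 1)/(z - 1)` takes the unit disc into the left half plane, where `|exp| ≤ 1`.
-/
theorem isHInf_singularInner : IsHInf singularInner := by
  have hne : ∀ Z ∈ matBall, Z 0 0 - 1 ≠ 0 := fun Z hZ h => by
    have := norm_apply_lt_one hZ 0 0
    rw [sub_eq_zero.1 h, norm_one] at this
    exact lt_irrefl _ this
  refine ⟨fun Z hZ => ?_, 1, fun Z hZ => ?_⟩
  · have := hne Z hZ
    unfold singularInner
    refine DifferentiableAt.differentiableWithinAt ?_
    fun_prop (disch := assumption)
  · rw [singularInner, Complex.norm_exp, Real.exp_le_one_iff]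
    have h1 := norm_apply_lt_one hZ 0 0
    have h2 : Complex.normSq (Z 0 0) < 1 := by
      rw [Complex.normSq_eq_norm_sq]
      nlinarith [norm_nonneg (Z 0 0)]
    rw [Complex.normSq_apply] at h2
    rw [Complex.div_re, ← add_div]
    refine div_nonpos_of_nonpos_of_nonneg ?_ (Complex.normSq_nonneg _)
    simp
    nlinarith

theorem not_exists_continuous_extension_singularInner :
    ¬ ∃ g : Mat2 → ℂ, ContinuousOn g (closure matBall) ∧ EqOn g singularInner matBall := by
  rintro ⟨g, hg, hgf⟩
  -- Solves `(z + 1)/(z - 1) = -1 - iy`. As `y → ∞` the point tends to `1` inside the disc, while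
  -- the function runs around the circle of radius `e⁻¹`; the values at `2πn` and `2πn + π` are
  -- opposite.
  let z : ℝ → ℂ := fun y => 1 - 2 / (2 + y * Complex.I)
  have hne : ∀ y : ℝ, (2 + y * Complex.I : ℂ) ≠ 0 := fun y h => by
    have := congrArg Complex.re h
    simp at this
  have hz : ∀ y, ‖z y‖ < 1 := by
    intro y
    have h1 : z y = (y * Complex.I) / (2 + y * Complex.I) := by
      simp only [z]
      field_simp [hne y]
      ring
    rw [h1, norm_div, div_lt_one (norm_pos_iff.2 (hne y)), ← sq_lt_sq₀ (norm_nonneg _) (norm_nonneg _),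
      ← Complex.normSq_eq_norm_sq, ← Complex.normSq_eq_norm_sq, Complex.normSq_apply,
      Complex.normSq_apply]
    simp
  have hval : ∀ y, g (z y • matUnit) = Complex.exp (-1 - y * Complex.I) := by
    intro y
    rw [hgf (smul_mem_matBall_of_mem_closure matUnit_mem (hz y)), singularInner]
    congr 1
    have h1 : (z y • matUnit) 0 0 = z y := by simp [matUnit]
    rw [h1]
    have h2 : z y - 1 = -2 / (2 + y * Complex.I) := by simp only [z]; ring
    have h3 : z y + 1 = (2 + 2 * y * Complex.I) / (2 + y * Complex.I) := by
      simp only [z]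
      field_simp [hne y]
      ring
    rw [h2, h3, div_div_div_cancel_right₀ (hne y)]
    ring
  have hz1 : Filter.Tendsto z Filter.atTop (nhds 1) := by
    have h1 : Filter.Tendsto (fun y : ℝ => 2 / (2 + y * Complex.I)) Filter.atTop (nhds 0) := by
      refine squeeze_zero_norm' (a := fun y : ℝ => 2 / y) ?_
        (tendsto_const_nhds.div_atTop Filter.tendsto_id)
      filter_upwards [Filter.eventually_gt_atTop 0] with y hy
      rw [norm_div, Complex.norm_ofNat]
      refine div_le_div_of_nonneg_left zero_le_two hy ?_
      have := Complex.abs_im_le_norm (2 + y * Complex.I)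
      simpa [abs_of_pos hy] using this
    simpa [z] using h1.const_sub 1
  have hlim : Filter.Tendsto (fun y => g (z y • matUnit)) Filter.atTop (nhds (g matUnit)) := by
    refine (hg matUnit matUnit_mem).tendsto.comp (tendsto_nhdsWithin_iff.2 ⟨?_, ?_⟩)
    · simpa using hz1.smul_const matUnit
    · exact Filter.Eventually.of_forall fun y =>
        subset_closure (smul_mem_matBall_of_mem_closure matUnit_mem (hz y))
  have hseq : Filter.Tendsto (fun n : ℕ => (n : ℝ) * (2 * Real.pi)) Filter.atTop Filter.atTop :=
    tendsto_natCast_atTop_atTop.atTop_mul_const (by positivity)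
  have e1 : ∀ n : ℕ, g (z (n * (2 * Real.pi)) • matUnit) = Complex.exp (-1) := fun n => by
    rw [hval, Complex.exp_sub]
    push_cast
    rw [show (n : ℂ) * (2 * Real.pi) * Complex.I = n * (2 * Real.pi * Complex.I) by ring,
      Complex.exp_nat_mul_two_pi_mul_I, div_one]
  have e2 : ∀ n : ℕ, g (z (n * (2 * Real.pi) + Real.pi) • matUnit) = -Complex.exp (-1) := fun n => by
    rw [hval, Complex.exp_sub]
    push_cast
    rw [show ((n : ℂ) * (2 * Real.pi) + Real.pi) * Complex.I =
      n * (2 * Real.pi * Complex.I) + Real.pi * Complex.I by ring, Complex.exp_add,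
      Complex.exp_nat_mul_two_pi_mul_I, Complex.exp_pi_mul_I, one_mul, div_neg, div_one]
  have l1 := hlim.comp hseq
  have l2 := hlim.comp (Filter.tendsto_atTop_add_const_right _ Real.pi hseq)
  have l1' := tendsto_nhds_unique l1 (tendsto_const_nhds.congr fun n => (e1 n).symm)
  have l2' := tendsto_nhds_unique l2 (tendsto_const_nhds.congr fun n => (e2 n).symm)
  exact Complex.exp_ne_zero (-1) (self_eq_neg.1 (l1'.symm.trans l2'))

theorem Ppol_lt_Ppp : Ppol lam < Ppp lam := by
  refine lt_of_le_not_ge (fun A hA => ?_) fun h => ?_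
  · obtain ⟨g, hg⟩ := exists_isSymbol hA
    obtain ⟨f, hf, -, rfl⟩ := hg.exists_eq_annih
    exact ⟨f, hf, rfl⟩
  · exact not_exists_continuous_extension_singularInner
      ((annih_mem_Ppol_iff isHInf_singularInner).1 (h ⟨_, isHInf_singularInner, rfl⟩))

/-! ### Cyclicity of the vacuum -/

theorem oneVec_eq_smul_vacuum : oneVec lam = ((mu lam).real univ : ℂ) • vacuum lam := by
  refine ext_inner_left ℂ fun ψ => ?_
  -- Degree `0` is the mean value property: only the value at `0` survives, times the total mass.
  -- Its value does not matter for cyclicity, so it is left as a scalar.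
  rw [inner_eq_integral_homComp ψ (oneVec lam) (q := fun _ => 1) (k := 0) (by simp)
    fun Z hZ => holRep_oneVec lam hZ, inner_smul_right, vacuum, inner_coh_right]
  simp [homComp]

theorem dense_vacuum : Dense {ψ : Hilb lam | ∃ B ∈ star (Ppol lam), ψ = B (vacuum lam)} := by
  let S : Submodule ℂ (Hilb lam) := (Subalgebra.toSubmodule (star (Ppol lam))).map
    (ContinuousLinearMap.apply ℂ (Hilb lam) (vacuum lam)).toLinearMap
  have hS : {ψ : Hilb lam | ∃ B ∈ star (Ppol lam), ψ = B (vacuum lam)} = S := by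
    ext ψ
    exact ⟨fun ⟨B, hB, h⟩ => ⟨B, hB, h.symm⟩, fun ⟨B, hB, h⟩ => ⟨B, hB, h.symm⟩⟩
  rw [hS, Submodule.dense_iff_topologicalClosure_eq_top, Submodule.topologicalClosure_eq_top_iff,
    Submodule.eq_bot_iff]
  intro ψ hψ
  have hF := differentiableOn_holRep lam ψ
  have hcomp : ∀ k, ∀ Z ∈ matBall, homComp (holRep lam ψ) k Z = 0 := by
    intro k
    obtain ⟨p, -, hpe⟩ := exists_homComp_eq_eval k hF
    -- The test vector is the degree `k` component of `ψ` itself, produced from the vacuum by the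
    -- adjoint of a polynomial operator. Then `⟨ψ, φ⟩ = ⟨φ, φ⟩`, and orthogonality kills it.
    obtain ⟨f, hf, hfp, hA⟩ := (isSymbol_polOp (lam := lam) p).exists_eq_annih
    set φ := conjMul lam hf (oneVec lam) with hφ
    have hrep : EqOn (holRep lam φ) (homComp (holRep lam ψ) k) matBall := fun Z hZ => by
      rw [hφ, holRep_conjMul lam hf _ hZ]
      simp only [holRep_oneVec lam hZ, mul_one]
      rw [hfp Z hZ, polRestrict_apply, hpe]
    have hstar : conjMul lam hf ∈ star (Ppol lam) := by
      rw [Subalgebra.mem_star_iff, ContinuousLinearMap.star_eq_adjoint]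
      exact (hA ▸ (polOp lam p).2 : annih lam hf ∈ Ppol lam)
    have h0 : ⟪ψ, φ⟫_ℂ = 0 := by
      have h : ⟪ψ, conjMul lam hf (vacuum lam)⟫_ℂ = 0 :=
        Submodule.inner_left_of_mem_orthogonal (K := S) ⟨_, hstar, rfl⟩ hψ
      rw [hφ, oneVec_eq_smul_vacuum, map_smul, inner_smul_right, h, mul_zero]
    rw [inner_eq_integral_homComp ψ φ (homComp_smul hF k) hrep] at h0
    have h1 : ⟪φ, φ⟫_ℂ = 0 := by
      rw [inner_eq_integral, ← h0]
      refine integral_congr_ae ?_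
      filter_upwards [ae_mem_matBall lam] with Z hZ
      rw [hrep hZ]
    intro Z hZ
    rw [← hrep hZ, ← inner_coh_right lam φ ⟨Z, hZ⟩, inner_self_eq_zero.1 h1, inner_zero_left]
  refine ext_holRep lam fun Z hZ => ?_
  rw [← inner_coh_right lam 0 ⟨Z, hZ⟩, inner_zero_left]
  -- The expansion needs a parameter of modulus below `1`, so `Z` is viewed as a contraction of the
  -- slightly larger point `(1 + ε/2) Z`, which is still in the open ball.
  obtain ⟨ε, hε, hsub⟩ := Metric.isOpen_iff.1 (isOpen_slice Z) 1 (by simpa using hZ)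
  have hW : ((1 + ε / 2 : ℝ) : ℂ) • Z ∈ matBall := hsub (by
    rw [mem_ball, dist_eq_norm]
    simp [abs_of_pos hε]
    linarith)
  have h := hasSum_homComp hF (subset_closure hW) (r := ((1 + ε / 2 : ℝ) : ℂ)⁻¹) (by
    rw [norm_inv, Complex.norm_real, Real.norm_of_nonneg (by positivity)]
    exact inv_lt_one_of_one_lt₀ (by linarith))
  rw [inv_smul_smul₀ (by exact_mod_cast (by positivity : (1 + ε / 2 : ℝ) ≠ 0))] at h
  simp only [hcomp _ _ hW, mul_zero] at h
  exact h.unique hasSum_zero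

end

end MatrixBall

end

theorem mainTheorem3 (lam : ℕ) [Fact (3 < lam)] :
    -- (i) `f ↦ a(f)` is an isometric isomorphism of the closure of `Pol` onto `P⁺⁺_pol`
    (∃ Φ : PolClosure ≃ₐ[ℂ] Ppol lam,
      (∀ f, ‖Φ f‖ = ‖f‖) ∧
      ∀ (f : PolClosure) (Z : matBall),
        (Φ f : Hilb lam →L[ℂ] Hilb lam) (coh lam Z) =
          (f : C(closure matBall, ℂ)) ⟨Z, subset_closure Z.2⟩ • coh lam Z) ∧
    -- `a(f) ∈ P⁺⁺_pol` iff `f` is continuous up to the boundary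
    (∀ (f : Mat2 → ℂ) (hf : IsHInf f),
      annih lam hf ∈ Ppol lam ↔
        ∃ g : Mat2 → ℂ, ContinuousOn g (closure matBall) ∧ Set.EqOn g f matBall) ∧
    -- the maximal ideal space is the closed ball
    (∃ e : WeakDual.characterSpace ℂ (Ppol lam) ≃ₜ closure matBall,
      ∀ χ k l, (e χ : Mat2) k l = χ ⟨coordOp lam k l, coordOp_mem_Ppol lam k l⟩) ∧
    -- (ii) semisimplicity
    (Ring.jacobson (Ppol lam) = ⊥ ∧
      ∀ p ∈ Ppol lam, (∀ c : ℂ, IsUnit (1 + c • p)) → p = 0) ∧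
    -- (iii) `P⁺⁺_pol` is a proper subalgebra of `P⁺⁺`
    Ppol lam < Ppp lam ∧
    -- (iv) the vacuum is cyclic for the adjoint algebra
    Dense {ψ : Hilb lam | ∃ B ∈ star (Ppol lam), ψ = B (vacuum lam)} := by
  exact ⟨⟨symbolEquiv lam, norm_symbolEquiv, isSymbol_symbolEquiv⟩, fun _ hf => annih_mem_Ppol_iff hf,
    exists_homeomorph, ⟨jacobson_Ppol, fun _ hp h => eq_zero_of_forall_isUnit hp h⟩, Ppol_lt_Ppp,
    dense_vacuum⟩
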